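/- A $0$-dimensional local field is a finite field; for $n\ge 1$ an $n$-dimensional local field is a complete discrete valuation field $F$ whose residue field $\overline F=\mathcal O_F/\mathfrak p_F$ is an $(n-1)$-dimensional local field. For a complete discrete valuation field $K$ let $$K\{\{t\}\}=\Big\{\sum_{i\in\mathbb Z}a_it^i:\ a_i\in K,\ \inf_i v_K(a_i)>-\infty,\ \lim_{i\to-\infty}a_i=0\Big\},$$ with the usual addition and multiplication of series and the valuation $v(\sum a_it^i)=\inf_i v_K(a_i)$; its residue field is $\overline K((t))$. A field $F\simeq K\{\{t_1\}\}\cdots\{\{t_m\}\}$ ($m\ge 0$), with $K$ a $1$-dimensional local field of characteristic $0$ (so with finite residue field), is called standard. The canonical lifting $h:\overline F\to\mathcal O_F$ attached to such a presentation is the Teichmüller lifting if $m=0$, and is given by $\sum_i a_it_m^i\mapsto\sum_i h'(a_i)t_m^i$ if $m\ge1$, where $h'$ is the canonical lifting for $K\{\{t_1\}\}\cdots\{\{t_{m-1}\}\}$. Higher topologies are defined by induction on the dimension. On a finite field the higher topology is the discrete one. Let $F$ be an $n$-dimensional local field, $n\ge1$, and let $\overline F$ carry a higher topology. For a map $h:\overline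 F\to\mathcal O_F$ and a uniformizer $\pi$ of $F$ let $\tau_{h,\pi}$ be the translation-invariant topology on $F$ with base at $0$ formed by the sets $$\Big\{\sum_{i\gg-\infty}h(f_i)\pi^i:\ f_i\in U_i\Big\},$$ where $(U_i)_{i\in\mathbb Z}$ runs through the sequences of open neighbourhoods of $0$ in $\overline F$ with $U_i=\overline F$ for all large $i$. A topology on $F$ is a higher topology constructed from that of $\overline F$ if it arises in one of the following ways. (1) (Equal characteristic.) It is $\tau_{h,\pi}$ where $h$ is a ring homomorphism splitting the residue map (so that $F\simeq\overline F((t))$, $t\leftrightarrow\pi$). (2) ($F$ standard.) It is $\tau_{h,\pi}$ where $h$ is the canonical lifting attached to some presentation of $F$ as a standard field. (3) ($F$ of mixed characteristic.) It is the product topology on $F\simeq M^{[F:M]}$, for some standard subfield $M\subseteq F$ with $[F:M]<\infty$, some $M$-basis of $F$, and a topology on $M$ as in (2), constructed from some higher topology on $\overline M$. (In case (3) the topology given on $\overline F$ may be any higher topology on $\overline F$.) Theorem. Let $n\ge1$, let $F$ be an $n$-dimensional local field, let $\overline F$ carry a higher topology, and let $\tau$ be any higher topology on $F$ constructed from it.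 Then the residue homomorphism $\rho:\mathcal O_F\to\overline F$ is an open map, where $\mathcal O_F$ has the subspace topology of $\tau$ and $\overline F$ has its given higher topology. -/

import Mathlib

open Filter Topology

universe u

namespace HigherLocal

/-- `O` is the ring of integers of a complete discrete valuation on the field `F`. -/
structure IsCompleteDVR {F : Type u} [Field F] (O : ValuationSubring F) : Prop where
  dvr : IsDiscreteValuationRing O
  complete : IsAdicComplete (IsLocalRing.maximalIdeal O) O

/-- `n`-dimensional local fields: a finite field for `n = 0`; for `n + 1`, a complete discrete
valuation field whose residue field is an `n`-dimensional local field. -/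
def IsHigherLocalField : ℕ → ∀ (F : Type u) [Field F], Prop
  | 0 => fun F _ => Finite F
  | n + 1 => fun F _ => ∃ O : ValuationSubring F,
      IsCompleteDVR O ∧ IsHigherLocalField n (IsLocalRing.ResidueField O)

/-- The valuation topology on `F`. -/
@[reducible]
noncomputable def valTopology {F : Type u} [Field F] (O : ValuationSubring F) : TopologicalSpace F :=
  O.valuation.subgroups_basis.topology

/-! ### The fields `K{{t}}` -/

/-- The set `K{{t}}` of series `∑_{i ∈ ℤ} a_i t^i` (given by their coefficients) with `a_i ∈ K`
of valuation bounded below and `a_i → 0` as `i → -∞`. -/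
def CurlySeries {K : Type u} [Field K] (OK : ValuationSubring K) : Set (ℤ → K) :=
  {a | (∃ d : K, d ≠ 0 ∧ ∀ i, d * a i ∈ OK) ∧
    @Tendsto ℤ K a atBot (@nhds K (valTopology OK) 0)}

/-- `Φ : K{{t}} → F` is an isomorphism of discrete valuation fields. The operations of `K{{t}}`
are the addition and the multiplication of series, the coefficients `∑_j a_j b_{i-j}` of a product
being convergent sums in `K`; the valuation of a series is the infimum of those of its
coefficients. -/
structure IsCurlyIso {K F : Type u} [Field K] [Field F]
    (OK : ValuationSubring K) (OF : ValuationSubring F) (Φ : CurlySeries OK ≃ F) : Prop where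
  map_add : ∀ a b c : CurlySeries OK, (∀ i, c.1 i = a.1 i + b.1 i) → Φ c = Φ a + Φ b
  map_mul : ∀ a b c : CurlySeries OK,
    (∀ i, @HasSum K ℤ _ (valTopology OK) (fun j => a.1 j * b.1 (i - j)) (c.1 i)
      (SummationFilter.unconditional ℤ)) →
    Φ c = Φ a * Φ b
  mem_iff : ∀ a : CurlySeries OK, Φ a ∈ OF ↔ ∀ i, a.1 i ∈ OK

/-- `F` (with ring of integers `O`) is a standard mixed characteristic field
`K{{t_1}}⋯{{t_m}}`, where `K` is a one-dimensional local field of mixed characteristic, and `h` is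
the canonical lifting of the residue field attached to this presentation. For `F = K` it is the
Teichmüller (that is, the multiplicative) lifting; for `F = K{{t}}`, whose residue field consists
of the Laurent series in `t` over the residue field of `K`, it is
`∑_{i ≥ m} a_i t^i ↦ ∑_{i ≥ m} h_K(a_i) t^i`, where `h_K` is the canonical lifting for `K`. -/
inductive IsCanonicalLifting : ∀ {F : Type u} [Field F] (O : ValuationSubring F),
    (IsLocalRing.ResidueField O → O) → Prop
  | base {K : Type u} [Field K] [CharZero K] (OK : ValuationSubring K) (hOK : IsCompleteDVR OK)
      (hfin : Finite (IsLocalRing.ResidueField OK))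
      (h : IsLocalRing.ResidueField OK →* OK)
      (hsec : ∀ a, IsLocalRing.residue OK (h a) = a) :
      IsCanonicalLifting OK h
  | step {K F : Type u} [Field K] [Field F] (OK : ValuationSubring K) (OF : ValuationSubring F)
      (hK : IsLocalRing.ResidueField OK → OK) (hhK : IsCanonicalLifting OK hK)
      (hOF : IsCompleteDVR OF)
      (Φ : CurlySeries OK ≃ F) (hΦ : IsCurlyIso OK OF Φ)
      (h : IsLocalRing.ResidueField OF → OF)
      (hh : ∀ (a : ℤ → IsLocalRing.ResidueField OK) (x : CurlySeries OK) (y : OF),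
        (∃ m : ℤ, ∀ i < m, a i = 0) → (∀ i, x.1 i = (hK (a i) : K)) → (y : F) = Φ x →
        h (IsLocalRing.residue OF y) = y) :
      IsCanonicalLifting OF h

/-! ### Lifting a topology from the residue field -/

/-- `x = ∑_{i ≫ -∞} h(f_i) π^i`, the series converging in the valuation topology of `F`. -/
def IsSeriesSum {F : Type u} [Field F] (O : ValuationSubring F)
    (h : IsLocalRing.ResidueField O → O) (π : O) (f : ℤ → IsLocalRing.ResidueField O)
    (x : F) : Prop :=
  (∃ m : ℤ, ∀ i < m, f i = 0) ∧
    @HasSum F ℤ _ (valTopology O) (fun i => (h (f i) : F) * (π : F) ^ i) x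
      (SummationFilter.unconditional ℤ)

/-- A sequence `(U_i)_{i ∈ ℤ}` of open neighbourhoods of zero such that `U_i` is everything for
all large `i`. -/
structure IsAdmissible {k : Type u} [Field k] (σ : TopologicalSpace k) (U : ℤ → Set k) :
    Prop where
  isOpen : ∀ i, IsOpen[σ] (U i)
  zero_mem : ∀ i, (0 : k) ∈ U i
  eventually_univ : ∃ i₀ : ℤ, ∀ i ≥ i₀, U i = Set.univ

/-- The basic set `{∑_{i ≫ -∞} h(f_i) π^i | f_i ∈ U_i}`. -/
def basicSet {F : Type u} [Field F] (O : ValuationSubring F)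
    (h : IsLocalRing.ResidueField O → O) (π : O) (U : ℤ → Set (IsLocalRing.ResidueField O)) :
    Set F :=
  {x | ∃ f : ℤ → IsLocalRing.ResidueField O, (∀ i, f i ∈ U i) ∧ IsSeriesSum O h π f x}

/-- The translation invariant topology on `F` in which the sets `basicSet O h π U`, for admissible
`U`, form a base at zero: a set is open if and only if it contains, with each of its points `x`,
some translate `x + basicSet O h π U`. -/
@[reducible]
def seriesTopology {F : Type u} [Field F] (O : ValuationSubring F)
    (σ : TopologicalSpace (IsLocalRing.ResidueField O))
    (h : IsLocalRing.ResidueField O → O) (π : O) : TopologicalSpace F where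
  IsOpen V := ∀ x ∈ V, ∃ U, IsAdmissible σ U ∧ ∀ y ∈ basicSet O h π U, x + y ∈ V
  isOpen_univ := fun _ _ => ⟨fun _ => Set.univ,
    ⟨fun _ => @isOpen_univ _ σ, fun _ => trivial, 0, fun _ _ => rfl⟩, fun _ _ => trivial⟩
  isOpen_inter := by
    intro V W hV hW x hx
    obtain ⟨U₁, h₁, hs₁⟩ := hV x hx.1
    obtain ⟨U₂, h₂, hs₂⟩ := hW x hx.2
    obtain ⟨i₁, e₁⟩ := h₁.eventually_univ
    obtain ⟨i₂, e₂⟩ := h₂.eventually_univ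
    refine ⟨fun i => U₁ i ∩ U₂ i,
      ⟨fun i => @IsOpen.inter _ σ _ _ (h₁.isOpen i) (h₂.isOpen i),
        fun i => ⟨h₁.zero_mem i, h₂.zero_mem i⟩, max i₁ i₂, fun i hi => ?_⟩, ?_⟩
    · simp [e₁ i (le_trans (le_max_left _ _) hi), e₂ i (le_trans (le_max_right _ _) hi)]
    · rintro y ⟨f, hf, hy⟩
      exact ⟨hs₁ y ⟨f, fun i => (hf i).1, hy⟩, hs₂ y ⟨f, fun i => (hf i).2, hy⟩⟩
  isOpen_sUnion := by
    intro S hS x ⟨V, hV, hx⟩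
    obtain ⟨U, hU, hs⟩ := hS V hV x hx
    exact ⟨U, hU, fun y hy => ⟨V, hV, hs y hy⟩⟩

/-- The topologies on `F` obtained from the topology `σ` of its residue field `k`; here `P` is the
predicate "is a higher topology" in the dimension of `k`.

* If `F` and `k` have the same characteristic: choose an isomorphism `F ≃ k((t))`, that is, a
  coefficient field (a ring homomorphism `s : k → O` splitting the residue map) and a uniformizer
  `π`, corresponding to `t`; elements of `F` are the series `∑ s(f_i) π^i`.
* If `F` is a standard mixed characteristic field: use the canonical lifting attached to a
  presentation `F ≃ K{{t_1}}⋯{{t_m}}` and a uniformizer.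
* If `F` is any field of mixed characteristic: choose a standard subfield `M` over which `F` is
  finite, topologize `M` as before, starting from a higher topology of its residue field, and give
  `F` the product topology through a linear isomorphism `F ≃ M^[F:M]`. -/
inductive IsConstructedFrom (P : ∀ (k : Type u) [Field k], TopologicalSpace k → Prop)
    {F : Type u} [Field F] (O : ValuationSubring F)
    (σ : TopologicalSpace (IsLocalRing.ResidueField O)) : TopologicalSpace F → Prop
  | equalChar (s : IsLocalRing.ResidueField O →+* O)
      (hs : ∀ a, IsLocalRing.residue O (s a) = a) (π : O) (hπ : Irreducible π) :
      IsConstructedFrom P O σ (seriesTopology O σ s π)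
  | standard (h : IsLocalRing.ResidueField O → O) (hh : IsCanonicalLifting O h)
      (π : O) (hπ : Irreducible π) :
      IsConstructedFrom P O σ (seriesTopology O σ h π)
  | finite (M : Subfield F) [FiniteDimensional M F]
      (OM : ValuationSubring M) (hOM : OM = O.comap (algebraMap M F)) (hM : IsCompleteDVR OM)
      (σM : TopologicalSpace (IsLocalRing.ResidueField OM))
      (hσM : P (IsLocalRing.ResidueField OM) σM)
      (h : IsLocalRing.ResidueField OM → OM) (hh : IsCanonicalLifting OM h)
      (π : OM) (hπ : Irreducible π)
      (b : Module.Basis (Fin (Module.finrank M F)) M F) :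
      IsConstructedFrom P O σ
        (TopologicalSpace.induced b.equivFun
          (@Pi.topologicalSpace _ (fun _ => M) (fun _ => seriesTopology OM σM h π)))

/-- Higher topologies on an `n`-dimensional local field: the discrete topology on a finite field
for `n = 0`; for `n + 1`, the topologies constructed from a higher topology on the residue
field. -/
def IsHigherTopology : ℕ → ∀ (F : Type u) [Field F], TopologicalSpace F → Prop
  | 0 => fun F _ τ => Finite F ∧ τ = ⊥
  | n + 1 => fun F _ τ =>
      ∃ (O : ValuationSubring F) (σ : TopologicalSpace (IsLocalRing.ResidueField O)),
        IsCompleteDVR O ∧ IsHigherTopology n (IsLocalRing.ResidueField O) σ ∧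
          IsConstructedFrom (IsHigherTopology n) O σ τ

end HigherLocal

/-!
Openness of the residue map concerns small neighbourhoods only: higher topologies are translation
invariant, so it suffices to lift a small element `a` of the residue field to a small integer.
For the topologies given by series in a uniformizer `π` one takes the lifting `h a`, a series
concentrated in degree zero (`isOpenMap_residue_seriesTopology`).

The remaining case is a finite extension `F` of a standard field `M`
(`isOpenMap_residue_finite`). There the topologies of the residue fields `l` of `F` and `k` of `M`
are chosen independently of each other. One writes `a` in a basis of `l` over `k`, and adds up lifts
of the basis elements, multiplied by the canonical liftings of the coordinates of `a`. Two facts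
show that the result is small.

*The coordinates of `a` are small.* The fields `k` and `l` have positive characteristic `p`, where
higher topologies come from coefficient fields only, and linear maps between finite extensions are
continuous for all choices of higher topologies (`continuous_of_semilinear`). This is an induction
on the dimension. Coefficient fields are not compatible with each other, but any two lifts of an
element have the same `p ^ r`-th power modulo the `p ^ r`-th power of the maximal ideal. So each
coefficient of a linear map is semilinear over the image of a power of the Frobenius, which has
finite index (`IsHigherTopology.frobenius_finite`), and the induction hypothesis applies to it. That
the valuations of the fields involved are compatible comes from Hensel's lemma: elements of `1 + I`
have roots of large order (`map_mem_of_henselianRing`, `map_mem_iff`).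

*The coordinates of the lift in `M` are small.* The canonical lifting `h` of `M` is neither additive
nor multiplicative in general. Its behaviour is controlled by the good subgroups `G` of `M`, for
which `h a * c` belongs to `G` whenever `a` is small, depending on `c` in `M`. By induction along
the presentation of `M`, enough good subgroups exist to have arbitrarily small reductions
(`IsCanonicalLifting.hasGoodReduction`): for `K{{t}}` one imposes conditions coefficientwise, and
the residue field is identified with Laurent series in `t` (`exists_coefficientField`), which is
harmless by the uniqueness of higher topologies in characteristic `p`. It follows that each basic
set of `M` contains a good subgroup (`exists_good_le_basicSet`).
-/

namespace HigherLocal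

/-! ### The lattices `π ^ n O` -/

section Lattices

variable {F : Type u} [Field F] {O : ValuationSubring F} {π : O}

/-- The fractional ideal `π ^ n O` of the valuation ring `O`, as an additive subgroup of `F`. -/
def lat (O : ValuationSubring F) (π : O) (n : ℤ) : AddSubgroup F where
  carrier := {x | (π : F) ^ (-n) * x ∈ O}
  zero_mem' := by simp [O.zero_mem]
  add_mem' := by
    intro a b ha hb
    simp only [Set.mem_ofPred_eq, mul_add] at *
    exact O.add_mem _ _ ha hb
  neg_mem' := by
    intro a ha
    simp only [Set.mem_ofPred_eq, mul_neg] at *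
    exact O.neg_mem _ ha

theorem mem_lat {n : ℤ} {x : F} : x ∈ lat O π n ↔ (π : F) ^ (-n) * x ∈ O := Iff.rfl

theorem mem_lat_zero {x : F} : x ∈ lat O π 0 ↔ x ∈ O := by simp [mem_lat]

theorem coe_ne_zero (hπ : Irreducible π) : (π : F) ≠ 0 := fun h => hπ.ne_zero (Subtype.ext h)

theorem zpow_mul_mem_lat (hπ : Irreducible π) {n : ℤ} {x : F} (hx : x ∈ O) :
    (π : F) ^ n * x ∈ lat O π n := by
  have := coe_ne_zero hπ
  rw [mem_lat, ← mul_assoc, ← zpow_add₀ this]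
  simpa using hx

theorem zpow_mem_lat (hπ : Irreducible π) (n : ℤ) : (π : F) ^ n ∈ lat O π n := by
  simpa using zpow_mul_mem_lat hπ (n := n) O.one_mem

theorem mul_mem_lat (hπ : Irreducible π) {m n : ℤ} {x y : F} (hx : x ∈ lat O π m)
    (hy : y ∈ lat O π n) : x * y ∈ lat O π (m + n) := by
  have h := coe_ne_zero hπ
  rw [mem_lat] at *
  have := O.mul_mem _ _ hx hy
  rw [neg_add, zpow_add₀ h]
  convert this using 1
  ring

theorem zpow_mul_mem_lat_iff (hπ : Irreducible π) {m n : ℤ} {x : F} :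
    (π : F) ^ m * x ∈ lat O π (m + n) ↔ x ∈ lat O π n := by
  have h := coe_ne_zero hπ
  rw [mem_lat, mem_lat, ← mul_assoc, ← zpow_add₀ h]
  simp

theorem lat_anti (hπ : Irreducible π) {m n : ℤ} (hmn : m ≤ n) : lat O π n ≤ lat O π m := by
  intro x hx
  obtain ⟨k, rfl⟩ := Int.le.dest hmn
  have h1 : (π : F) ^ (k : ℤ) ∈ O := by simpa using O.toSubring.pow_mem π.2 k
  have h := coe_ne_zero hπ
  rw [mem_lat] at *
  have := O.mul_mem _ _ h1 hx
  rwa [← mul_assoc, ← zpow_add₀ h, show (k : ℤ) + -(m + k) = -m by ring] at this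

theorem mem_of_mem_lat (hπ : Irreducible π) {n : ℤ} (hn : 0 ≤ n) {x : F} (hx : x ∈ lat O π n) :
    x ∈ O := mem_lat_zero.1 (lat_anti hπ hn hx)

theorem mul_mem_lat_of_mem (hπ : Irreducible π) {n : ℤ} {x y : F} (hx : x ∈ O)
    (hy : y ∈ lat O π n) : x * y ∈ lat O π n := by
  simpa using mul_mem_lat hπ (m := 0) (mem_lat_zero.2 hx) hy

theorem pow_mem_lat (hπ : Irreducible π) {n : ℤ} {x : F} (hx : x ∈ lat O π n) (k : ℕ) :
    x ^ k ∈ lat O π (k * n) := by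
  induction k with
  | zero => simp [mem_lat_zero]
  | succ k ih => rw [pow_succ]; push_cast; rw [add_mul, one_mul]; exact mul_mem_lat hπ ih hx

theorem exists_unit_mul_zpow (hO : IsCompleteDVR O) (hπ : Irreducible π) {x : F} (hx : x ≠ 0) :
    ∃ (u : Oˣ) (n : ℤ), x = (u : O) * (π : F) ^ n := by
  have := hO.dvr
  have hO' : ∀ y : O, y ≠ 0 → ∃ (u : Oˣ) (n : ℕ), (y : F) = (u : O) * (π : F) ^ n := by
    intro y hy
    obtain ⟨n, u, h⟩ := IsDiscreteValuationRing.eq_unit_mul_pow_irreducible hy hπ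
    exact ⟨u, n, by rw [h]; rfl⟩
  rcases O.mem_or_inv_mem x with h | h
  · obtain ⟨u, n, h⟩ := hO' ⟨x, h⟩ (fun h => hx (congrArg Subtype.val h))
    exact ⟨u, n, by simpa using h⟩
  · obtain ⟨u, n, h⟩ := hO' ⟨x⁻¹, h⟩ (fun h => inv_ne_zero hx (congrArg Subtype.val h))
    refine ⟨u⁻¹, -n, ?_⟩
    have h2 : ((u⁻¹ : Oˣ) : O).1 * ((u : O) : F) = 1 := congrArg Subtype.val (Units.inv_mul u)
    have h3 : ((u : O) : F) ≠ 0 := right_ne_zero_of_mul_eq_one h2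
    rw [eq_inv_of_mul_eq_one_left h2, zpow_neg, ← mul_inv, zpow_natCast, ← h, inv_inv]

theorem unit_mul_zpow_mem_lat (hπ : Irreducible π) (u : Oˣ) {m n : ℤ} :
    ((u : O) : F) * (π : F) ^ m ∈ lat O π n ↔ n ≤ m := by
  have h := coe_ne_zero hπ
  constructor
  · intro hx
    by_contra! hlt
    have h1 := lat_anti hπ (Int.add_one_le_of_lt hlt) hx
    have h2 := mul_mem_lat_of_mem hπ (u⁻¹ : Oˣ).1.2 h1
    have h3 : ((u⁻¹ : Oˣ) : O).1 * ((u : O) : F) = 1 := congrArg Subtype.val (Units.inv_mul u)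
    rw [← mul_assoc, h3, one_mul, mem_lat, ← zpow_add₀ h,
      show -(m + 1) + m = -1 by ring, zpow_neg_one] at h2
    apply hπ.not_isUnit
    exact IsUnit.of_mul_eq_one ⟨_, h2⟩ (Subtype.ext (mul_inv_cancel₀ h))
  · intro hx
    exact mul_mem_lat_of_mem hπ (u : O).2 (lat_anti hπ hx (zpow_mem_lat hπ m))

theorem exists_mem_lat (hO : IsCompleteDVR O) (hπ : Irreducible π) (x : F) :
    ∃ n : ℤ, x ∈ lat O π n := by
  by_cases hx : x = 0
  · exact ⟨0, hx ▸ zero_mem _⟩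
  · obtain ⟨u, n, rfl⟩ := exists_unit_mul_zpow hO hπ hx
    exact ⟨n, (unit_mul_zpow_mem_lat hπ u).2 le_rfl⟩

theorem eq_zero_of_forall_mem_lat (hO : IsCompleteDVR O) (hπ : Irreducible π) {x : F}
    (h : ∀ n, x ∈ lat O π n) : x = 0 := by
  by_contra hx
  obtain ⟨u, n, rfl⟩ := exists_unit_mul_zpow hO hπ hx
  have := (unit_mul_zpow_mem_lat hπ u).1 (h (n + 1))
  omega

theorem eq_of_forall_sub_mem_lat (hO : IsCompleteDVR O) (hπ : Irreducible π) {x y : F} {m : ℤ}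
    (h : ∀ n, m ≤ n → x - y ∈ lat O π n) : x = y := by
  refine sub_eq_zero.1 (eq_zero_of_forall_mem_lat hO hπ fun n => ?_)
  rcases le_total m n with h1 | h1
  · exact h n h1
  · exact lat_anti hπ h1 (h m le_rfl)

theorem mem_maximalIdeal_pow_iff (hO : IsCompleteDVR O) (hπ : Irreducible π) {n : ℕ} {x : O} :
    x ∈ IsLocalRing.maximalIdeal O ^ n ↔ (x : F) ∈ lat O π n := by
  have := hO.dvr
  have h := coe_ne_zero hπ
  rw [hπ.maximalIdeal_eq, Ideal.span_singleton_pow, Ideal.mem_span_singleton', mem_lat]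
  constructor
  · rintro ⟨a, rfl⟩
    have : (π : F) ^ (-(n : ℤ)) * ((a * π ^ n : O) : F) = a := by
      push_cast
      rw [mul_comm (a : F), ← mul_assoc, ← zpow_natCast, ← zpow_add₀ h]
      simp
    rw [this]
    exact a.2
  · intro hx
    refine ⟨⟨_, hx⟩, Subtype.ext ?_⟩
    push_cast
    rw [mul_right_comm, ← zpow_natCast, ← zpow_add₀ h]
    simp

theorem residue_eq_zero_iff_mem_lat (hO : IsCompleteDVR O) (hπ : Irreducible π) {x : O} :
    IsLocalRing.residue O x = 0 ↔ (x : F) ∈ lat O π 1 := by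
  rw [IsLocalRing.residue_eq_zero_iff]
  simpa using mem_maximalIdeal_pow_iff hO hπ (n := 1) (x := x)

theorem residue_eq_iff_sub_mem_lat (hO : IsCompleteDVR O) (hπ : Irreducible π) {x y : O} :
    IsLocalRing.residue O x = IsLocalRing.residue O y ↔ (x : F) - y ∈ lat O π 1 := by
  rw [← sub_eq_zero, ← map_sub, residue_eq_zero_iff_mem_lat hO hπ]
  rfl

theorem exists_irreducible (hO : IsCompleteDVR O) : ∃ π : O, Irreducible π :=
  haveI := hO.dvr
  IsDiscreteValuationRing.exists_irreducible O

/-- Completeness, in the form: a sequence whose successive differences lie in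
`π ^ (m + k) O` converges. -/
theorem exists_limit (hO : IsCompleteDVR O) (hπ : Irreducible π) {m : ℤ} (S : ℕ → F)
    (hS : ∀ k : ℕ, S (k + 1) - S k ∈ lat O π (m + k)) :
    ∃ x, ∀ k : ℕ, x - S k ∈ lat O π (m + k) := by
  have h := coe_ne_zero hπ
  have hmn : ∀ k l : ℕ, S (k + l) - S k ∈ lat O π (m + k) := by
    intro k l
    induction l with
    | zero => simp
    | succ l ih =>
      have h1 := lat_anti hπ (m := m + k) (by push_cast; omega) (hS (k + l))
      simpa [add_assoc] using add_mem h1 ih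
  have h0 : ∀ k, (π : F) ^ (-m) * (S k - S 0) ∈ O := fun k => by
    have := hmn 0 k
    rw [mem_lat] at this
    simpa using this
  obtain ⟨L, hL⟩ := hO.complete.toIsPrecomplete.prec (f := fun k => (⟨_, h0 k⟩ : O)) (by
    intro k l hkl
    rw [SModEq.comm, SModEq.sub_mem, smul_eq_mul, Ideal.mul_top, mem_maximalIdeal_pow_iff hO hπ]
    obtain ⟨l, rfl⟩ := Nat.exists_eq_add_of_le hkl
    have : (π : F) ^ (-m) * (S (k + l) - S k) ∈ lat O π (-m + (m + k)) :=
      (zpow_mul_mem_lat_iff hπ).2 (hmn k l)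
    rw [neg_add_cancel_left] at this
    convert this using 1
    push_cast
    ring)
  refine ⟨(π : F) ^ m * L + S 0, fun k => ?_⟩
  have h1 := hL k
  rw [SModEq.comm, SModEq.sub_mem, smul_eq_mul, Ideal.mul_top, mem_maximalIdeal_pow_iff hO hπ,
    ← zpow_mul_mem_lat_iff hπ (m := m)] at h1
  convert h1 using 1
  push_cast
  rw [mul_sub, ← mul_assoc, ← zpow_add₀ h]
  simp
  ring

theorem mem_nhds_valTopology (hO : IsCompleteDVR O) (hπ : Irreducible π) {x : F} {V : Set F} :
    V ∈ @nhds F (valTopology O) x ↔ ∃ n : ℤ, ∀ y ∈ lat O π n, x + y ∈ V := by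
  have h := coe_ne_zero hπ
  rw [(O.valuation.subgroups_basis.hasBasis_nhds x).mem_iff]
  have key : ∀ y n, O.valuation y < O.valuation ((π : F) ^ n) → y ∈ lat O π n := by
    intro y n hy
    rw [mem_lat, ← O.valuation_le_one_iff, map_mul, zpow_neg, map_inv₀]
    have h0 : O.valuation ((π : F) ^ n) ≠ 0 :=
      (map_ne_zero O.valuation).2 (zpow_ne_zero n h)
    exact (inv_mul_le_one₀ (zero_lt_iff.2 h0)).2 hy.le
  constructor
  · rintro ⟨γ, -, hγ⟩
    obtain ⟨z, hz⟩ := O.valuation_surjective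
      (MonoidWithZeroHom.ValueGroup₀.embedding (f := .ofClass O.valuation) (γ : _))
    have hz0 : z ≠ 0 := by
      rintro rfl
      rw [map_zero] at hz
      have := (Units.map (MonoidWithZeroHom.ValueGroup₀.embedding
        (f := .ofClass O.valuation)).toMonoidHom γ).ne_zero
      exact this hz.symm
    obtain ⟨u, n, hu⟩ := exists_unit_mul_zpow hO hπ hz0
    refine ⟨n + 1, fun y hy => hγ ?_⟩
    simp only [Set.mem_ofPred_eq, add_sub_cancel_left]
    show O.valuation y < _
    refine lt_of_lt_of_eq (?_ : O.valuation y < O.valuation z) hz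
    by_contra! hle
    rw [O.valuation_le_iff] at hle
    obtain ⟨a, ha⟩ := hle
    have h1 := mul_mem_lat_of_mem hπ a.2 hy
    rw [ha, hu, unit_mul_zpow_mem_lat hπ] at h1
    omega
  · rintro ⟨n, hn⟩
    let γ' := MonoidWithZeroHom.ValueGroup₀.restrict₀ (.ofClass O.valuation) ((π : F) ^ n)
    have hγ' : γ' ≠ 0 := by
      intro h0
      rw [MonoidWithZeroHom.ValueGroup₀.restrict₀_eq_zero_iff] at h0
      exact zpow_ne_zero n h ((map_eq_zero O.valuation).1 h0)
    refine ⟨Units.mk0 γ' hγ', trivial, fun b hb => ?_⟩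
    have h1 := hn (b - x) (key _ _ (by
      have : O.valuation (b - x) < MonoidWithZeroHom.ValueGroup₀.embedding γ' := hb
      rwa [MonoidWithZeroHom.ValueGroup₀.embedding_restrict₀] at this))
    simpa using h1

theorem hasSum_valTopology_iff (hO : IsCompleteDVR O) (hπ : Irreducible π) {ι : Type*}
    {f : ι → F} {x : F} :
    @HasSum F ι _ (valTopology O) f x (SummationFilter.unconditional ι) ↔
      ∀ n : ℤ, ∃ s : Finset ι, ∀ t, s ⊆ t → x - ∑ i ∈ t, f i ∈ lat O π n := by
  have h0 : @HasSum F ι _ (valTopology O) f x (SummationFilter.unconditional ι) ↔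
      ∀ V ∈ @nhds F (valTopology O) x, ∃ s : Finset ι, ∀ t, s ⊆ t → ∑ i ∈ t, f i ∈ V := by
    unfold HasSum
    rw [SummationFilter.unconditional_filter, Filter.tendsto_def]
    simp only [Filter.mem_atTop_sets]
    rfl
  rw [h0]
  constructor
  · intro h n
    obtain ⟨s, hs⟩ := h {y | x - y ∈ lat O π n} ((mem_nhds_valTopology hO hπ).2
      ⟨n, fun y hy => by simpa using hy⟩)
    exact ⟨s, hs⟩
  · intro h V hV
    obtain ⟨n, hn⟩ := (mem_nhds_valTopology hO hπ).1 hV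
    obtain ⟨s, hs⟩ := h n
    refine ⟨s, fun t ht => ?_⟩
    have := hn _ (neg_mem (hs t ht))
    simpa using this

end Lattices

/-! ### Expansions in powers of a uniformizer -/

section Expansions

variable {F : Type u} [Field F] {O : ValuationSubring F} {π : O}
  {h : IsLocalRing.ResidueField O → O}

theorem sum_Ico_succ_of_le {M : Type*} [AddCommGroup M] (g : ℤ → M) {m n : ℤ} (hmn : m ≤ n) :
    ∑ i ∈ Finset.Ico m (n + 1), g i = ∑ i ∈ Finset.Ico m n, g i + g n := by
  have : Finset.Ico m (n + 1) = insert n (Finset.Ico m n) := by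
    ext i
    simp only [Finset.mem_Ico, Finset.mem_insert]
    omega
  rw [this, Finset.sum_insert (by simp), add_comm]

theorem term_mem_lat (hπ : Irreducible π) (a : O) (i : ℤ) : (a : F) * (π : F) ^ i ∈ lat O π i :=
  mul_mem_lat_of_mem hπ a.2 (zpow_mem_lat hπ i)

/-- The truncations of a convergent expansion approximate its sum. -/
theorem IsSeriesSum.sub_sum_mem_lat (hO : IsCompleteDVR O) (hπ : Irreducible π) (h0 : h 0 = 0)
    {f : ℤ → IsLocalRing.ResidueField O} {x : F} (hx : IsSeriesSum O h π f x) {m : ℤ}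
    (hm : ∀ i < m, f i = 0) (n : ℤ) :
    x - ∑ i ∈ Finset.Ico m n, (h (f i) : F) * (π : F) ^ i ∈ lat O π n := by
  obtain ⟨s, hs⟩ := (hasSum_valTopology_iff hO hπ).1 hx.2 n
  have h1 := hs (s ∪ Finset.Ico m n) Finset.subset_union_left
  have h2 : ∑ i ∈ s ∪ Finset.Ico m n, (h (f i) : F) * (π : F) ^ i
      - ∑ i ∈ Finset.Ico m n, (h (f i) : F) * (π : F) ^ i ∈ lat O π n := by
    rw [← Finset.sum_sdiff (Finset.subset_union_right (s₁ := s)), add_sub_cancel_right]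
    refine AddSubgroup.sum_mem _ fun i hi => ?_
    simp only [Finset.mem_sdiff, Finset.mem_Ico, not_and, not_lt] at hi
    by_cases him : m ≤ i
    · exact lat_anti hπ (hi.2 him) (term_mem_lat hπ _ i)
    · rw [hm i (not_le.1 him), h0]
      simp
  simpa using add_mem h1 h2

theorem isSeriesSum_of_sub_sum_mem_lat (hO : IsCompleteDVR O) (hπ : Irreducible π)
    {f : ℤ → IsLocalRing.ResidueField O} {x : F} {m : ℤ} (h0 : h 0 = 0)
    (hm : ∀ i < m, f i = 0)
    (hx : ∀ n, m ≤ n → x - ∑ i ∈ Finset.Ico m n, (h (f i) : F) * (π : F) ^ i ∈ lat O π n) :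
    IsSeriesSum O h π f x := by
  refine ⟨⟨m, hm⟩, (hasSum_valTopology_iff hO hπ).2 fun n => ?_⟩
  refine ⟨Finset.Ico m (max m n), fun t ht => ?_⟩
  have h1 := lat_anti hπ (le_max_right m n) (hx _ (le_max_left m n))
  rw [← Finset.sum_sdiff ht, add_comm, ← sub_sub]
  refine sub_mem h1 (AddSubgroup.sum_mem _ fun i hi => ?_)
  simp only [Finset.mem_sdiff, Finset.mem_Ico, not_and, not_lt] at hi
  by_cases him : m ≤ i
  · exact lat_anti hπ ((le_max_right _ _).trans (hi.2 him)) (term_mem_lat hπ _ i)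
  · rw [hm i (not_le.1 him), h0]
    simp

/-- Expansions exist as soon as the digits can be chosen one after the other: `P i y` is an
invariant of the `i`-th remainder `y`. -/
theorem exists_isSeriesSum_of_step (hO : IsCompleteDVR O) (hπ : Irreducible π) (h0 : h 0 = 0)
    (U : ℤ → Set (IsLocalRing.ResidueField O)) (hU : ∀ i, 0 ∈ U i) (P : ℤ → F → Prop)
    (hP : ∀ i y, P i y → ∃ a ∈ U i, P (i + 1) (y - (h a : F) * (π : F) ^ i))
    (hPlat : ∀ i y, P i y → y ∈ lat O π i) {m : ℤ} {x : F} (hx : P m x) :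
    ∃ f, (∀ i, f i ∈ U i) ∧ IsSeriesSum O h π f x := by
  choose! d hdU hdP using hP
  let R : ℕ → F := fun k => Nat.rec x (fun k y => y - (h (d (m + k) y) : F) * (π : F) ^ (m + k)) k
  have hR : ∀ k : ℕ, P (m + k) (R k) := by
    intro k
    induction k with
    | zero => simpa [R] using hx
    | succ k ih =>
      have := hdP _ _ ih
      rw [add_assoc] at this
      push_cast
      exact this
  let f : ℤ → IsLocalRing.ResidueField O := fun i => if m ≤ i then d i (R (i - m).toNat) else 0
  have hf : ∀ k : ℕ, f (m + k) = d (m + k) (R k) := fun k => by simp [f]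
  have hsum : ∀ k : ℕ, x - ∑ i ∈ Finset.Ico m (m + k), (h (f i) : F) * (π : F) ^ i = R k := by
    intro k
    induction k with
    | zero => simp [R]
    | succ k ih =>
      push_cast
      rw [← add_assoc, sum_Ico_succ_of_le _ (by omega), ← sub_sub, ih, hf]
  refine ⟨f, fun i => ?_, isSeriesSum_of_sub_sum_mem_lat hO hπ h0 (m := m) ?_ ?_⟩
  · by_cases hi : m ≤ i
    · obtain ⟨k, rfl⟩ := Int.le.dest hi
      rw [hf]
      exact hdU _ _ (hR k)
    · simp [f, hi, hU]
  · intro i hi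
    simp [f, not_le.2 hi]
  · intro n hn
    obtain ⟨k, rfl⟩ := Int.le.dest hn
    rw [hsum]
    exact hPlat _ _ (hR k)

/-- The class of `π ^ (-i) y` in the residue field is the digit that removes the leading term
of `y`. -/
theorem sub_digit_mem_lat (hO : IsCompleteDVR O) (hπ : Irreducible π)
    (hs : ∀ a, IsLocalRing.residue O (h a) = a) {i : ℤ} {y : F} (hy : y ∈ lat O π i) :
    y - (h (IsLocalRing.residue O ⟨_, hy⟩) : F) * (π : F) ^ i ∈ lat O π (i + 1) := by
  have hne := coe_ne_zero hπ
  have h1 : (π : F) ^ (-i) * y - (h (IsLocalRing.residue O ⟨_, hy⟩) : F) ∈ lat O π 1 :=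
    (residue_eq_iff_sub_mem_lat hO hπ (x := ⟨_, hy⟩)).1 (hs _).symm
  rw [← zpow_mul_mem_lat_iff hπ (m := i), mul_sub, ← mul_assoc, ← zpow_add₀ hne] at h1
  simpa [mul_comm] using h1

theorem exists_isSeriesSum (hO : IsCompleteDVR O) (hπ : Irreducible π) (h0 : h 0 = 0)
    (hs : ∀ a, IsLocalRing.residue O (h a) = a) (x : F) : ∃ f, IsSeriesSum O h π f x := by
  obtain ⟨m, hm⟩ := exists_mem_lat hO hπ x
  obtain ⟨f, -, hf⟩ := exists_isSeriesSum_of_step hO hπ h0 (fun _ => Set.univ) (fun _ => trivial)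
    (fun i y => y ∈ lat O π i) (fun i y hy => ⟨_, trivial, sub_digit_mem_lat hO hπ hs hy⟩)
    (fun i y hy => hy) hm
  exact ⟨f, hf⟩

end Expansions

/-! ### Coefficients with respect to a coefficient field -/

section Coefficients

variable {F : Type u} [Field F] {O : ValuationSubring F} {π : O}
  {s : IsLocalRing.ResidueField O →+* O}

theorem IsSeriesSum.add (hO : IsCompleteDVR O) (hπ : Irreducible π)
    {f g : ℤ → IsLocalRing.ResidueField O} {x y : F} (hx : IsSeriesSum O s π f x)
    (hy : IsSeriesSum O s π g y) : IsSeriesSum O s π (f + g) (x + y) := by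
  obtain ⟨m, hm⟩ := hx.1
  obtain ⟨m', hm'⟩ := hy.1
  have h1 : ∀ i < min m m', f i = 0 := fun i hi => hm i (by omega)
  have h2 : ∀ i < min m m', g i = 0 := fun i hi => hm' i (by omega)
  refine isSeriesSum_of_sub_sum_mem_lat hO hπ (m := min m m') (map_zero s) ?_ fun n _ => ?_
  · intro i hi
    simp [h1 i hi, h2 i hi]
  · convert add_mem (hx.sub_sum_mem_lat hO hπ (map_zero s) h1 n)
      (hy.sub_sum_mem_lat hO hπ (map_zero s) h2 n) using 1
    simp only [Pi.add_apply, map_add, AddMemClass.coe_add, add_mul, Finset.sum_add_distrib]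
    ring

theorem IsSeriesSum.const_mul (hO : IsCompleteDVR O) (hπ : Irreducible π)
    {f : ℤ → IsLocalRing.ResidueField O} {x : F} (b : IsLocalRing.ResidueField O)
    (hx : IsSeriesSum O s π f x) : IsSeriesSum O s π (fun i => b * f i) ((s b : F) * x) := by
  obtain ⟨m, hm⟩ := hx.1
  refine isSeriesSum_of_sub_sum_mem_lat hO hπ (m := m) (map_zero s) ?_ fun n _ => ?_
  · intro i hi
    simp [hm i hi]
  · convert mul_mem_lat_of_mem hπ (s b).2 (hx.sub_sum_mem_lat hO hπ (map_zero s) hm n) using 1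
    simp only [map_mul, MulMemClass.coe_mul, mul_sub, Finset.mul_sum, mul_assoc]

theorem IsSeriesSum.eq_zero_of_mem_lat (hO : IsCompleteDVR O) (hπ : Irreducible π)
    (hs : ∀ a, IsLocalRing.residue O (s a) = a)
    {f : ℤ → IsLocalRing.ResidueField O} {x : F} (hx : IsSeriesSum O s π f x) {n : ℤ}
    (hn : x ∈ lat O π n) : ∀ i < n, f i = 0 := by
  obtain ⟨m, hm⟩ := hx.1
  have key : ∀ k : ℕ, m + k ≤ n → ∀ i < m + k, f i = 0 := by
    intro k
    induction k with
    | zero => intro _ i hi; exact hm i (by simpa using hi)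
    | succ k ih =>
      intro hk i hi
      push_cast at hk hi
      have ih := ih (by omega)
      rcases lt_or_eq_of_le (show i ≤ m + k by omega) with h1 | rfl
      · exact ih i h1
      have h2 := hx.sub_sum_mem_lat hO hπ (map_zero s) ih (m + k + 1)
      rw [sum_Ico_succ_of_le _ le_rfl, Finset.Ico_self, Finset.sum_empty, zero_add] at h2
      have h3 := sub_mem (lat_anti hπ (show m + k + 1 ≤ n by omega) hn) h2
      rw [sub_sub_cancel, mul_comm, zpow_mul_mem_lat_iff hπ,
        ← residue_eq_zero_iff_mem_lat hO hπ, hs] at h3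
      exact h3
  intro i hi
  by_cases him : m ≤ n
  · obtain ⟨k, rfl⟩ := Int.le.dest him
    exact key k le_rfl i hi
  · exact hm i (by omega)

theorem IsSeriesSum.unique (hO : IsCompleteDVR O) (hπ : Irreducible π)
    (hs : ∀ a, IsLocalRing.residue O (s a) = a)
    {f g : ℤ → IsLocalRing.ResidueField O} {x : F} (hx : IsSeriesSum O s π f x)
    (hy : IsSeriesSum O s π g x) : f = g := by
  have h1 := hx.add hO hπ (hy.const_mul hO hπ (-1))
  have h2 : x + (s (-1) : F) * x = 0 := by simp
  rw [h2] at h1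
  funext i
  have := h1.eq_zero_of_mem_lat hO hπ hs (zero_mem (lat O π (i + 1))) i (by omega)
  simpa [← sub_eq_add_neg, sub_eq_zero] using this

/-- The coefficient of `π ^ i` in the expansion of `x` over the coefficient field `s`. -/
noncomputable def coef (O : ValuationSubring F) (s : IsLocalRing.ResidueField O →+* O) (π : O)
    (x : F) : ℤ → IsLocalRing.ResidueField O :=
  Classical.epsilon fun f => IsSeriesSum O s π f x

variable (hO : IsCompleteDVR O) (hπ : Irreducible π)
  (hs : ∀ a, IsLocalRing.residue O (s a) = a)

include hO hπ hs

theorem isSeriesSum_coef (x : F) : IsSeriesSum O s π (coef O s π x) x :=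
  Classical.epsilon_spec (exists_isSeriesSum hO hπ (map_zero s) hs x)

theorem IsSeriesSum.coef_eq {f : ℤ → IsLocalRing.ResidueField O} {x : F}
    (hx : IsSeriesSum O s π f x) : coef O s π x = f :=
  (isSeriesSum_coef hO hπ hs x).unique hO hπ hs hx

theorem coef_add (x y : F) : coef O s π (x + y) = coef O s π x + coef O s π y :=
  ((isSeriesSum_coef hO hπ hs x).add hO hπ (isSeriesSum_coef hO hπ hs y)).coef_eq hO hπ hs

theorem coef_mul (b : IsLocalRing.ResidueField O) (x : F) (i : ℤ) :
    coef O s π ((s b : F) * x) i = b * coef O s π x i :=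
  congrFun (((isSeriesSum_coef hO hπ hs x).const_mul hO hπ b).coef_eq hO hπ hs) i

theorem coef_eq_zero {x : F} {n i : ℤ} (hx : x ∈ lat O π n) (hi : i < n) :
    coef O s π x i = 0 :=
  (isSeriesSum_coef hO hπ hs x).eq_zero_of_mem_lat hO hπ hs hx i hi

theorem coef_zero : coef O s π 0 = 0 :=
  funext fun i => coef_eq_zero hO hπ hs (zero_mem (lat O π (i + 1))) (by omega)

theorem coef_neg (x : F) : coef O s π (-x) = -coef O s π x := by
  rw [eq_neg_iff_add_eq_zero, ← coef_add hO hπ hs, neg_add_cancel, coef_zero hO hπ hs]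

theorem coef_eq_of_sub_mem_lat {x y : F} {n i : ℤ} (hx : x - y ∈ lat O π n) (hi : i < n) :
    coef O s π x i = coef O s π y i := by
  have h1 := coef_eq_zero hO hπ hs hx hi
  rw [sub_eq_add_neg, coef_add hO hπ hs, coef_neg hO hπ hs, Pi.add_apply, Pi.neg_apply] at h1
  exact sub_eq_zero.1 (by rw [sub_eq_add_neg]; exact h1)

theorem mem_basicSet_iff {U : ℤ → Set (IsLocalRing.ResidueField O)} {x : F} :
    x ∈ basicSet O s π U ↔ ∀ i, coef O s π x i ∈ U i := by
  constructor
  · rintro ⟨f, hf, hx⟩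
    rwa [hx.coef_eq hO hπ hs]
  · intro h
    exact ⟨_, h, isSeriesSum_coef hO hπ hs x⟩

end Coefficients

/-! ### Linear topologies -/

/-- A translation invariant topology on a field `k` with a base at zero formed by open additive
subgroups. -/
def IsLinearTop {k : Type u} [Field k] (σ : TopologicalSpace k) : Prop :=
  ∀ V, IsOpen[σ] V ↔ ∀ x ∈ V, ∃ H : AddSubgroup k, IsOpen[σ] (H : Set k) ∧ ∀ y ∈ H, x + y ∈ V

namespace IsLinearTop

variable {k : Type u} [Field k] {σ : TopologicalSpace k}

theorem exists_subgroup (hσ : IsLinearTop σ) {V : Set k} (hV : IsOpen[σ] V) (h0 : 0 ∈ V) :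
    ∃ H : AddSubgroup k, IsOpen[σ] (H : Set k) ∧ (H : Set k) ⊆ V := by
  obtain ⟨H, hH, h⟩ := (hσ V).1 hV 0 h0
  exact ⟨H, hH, fun y hy => by simpa using h y hy⟩

theorem bot : @IsLinearTop k _ ⊥ := fun V =>
  ⟨fun _ x hx => ⟨⊥, trivial, fun y hy => by rw [AddSubgroup.mem_bot.1 hy]; simpa⟩,
    fun _ => trivial⟩

/-- An additive map between linear topologies is continuous once it is so at zero. -/
theorem continuous_of {k' : Type u} [Field k'] {σ' : TopologicalSpace k'} (hσ : IsLinearTop σ)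
    (hσ' : IsLinearTop σ') (L : k →+ k')
    (h : ∀ H : AddSubgroup k', IsOpen[σ'] (H : Set k') →
      ∃ H' : AddSubgroup k, IsOpen[σ] (H' : Set k) ∧ ∀ y ∈ H', L y ∈ H) :
    @Continuous _ _ σ σ' L := by
  refine @Continuous.mk _ _ σ σ' _ fun V hV => (hσ _).2 fun x hx => ?_
  obtain ⟨H, hH, hHV⟩ := (hσ' V).1 hV (L x) hx
  obtain ⟨H', hH', hL⟩ := h H hH
  exact ⟨H', hH', fun y hy => by simpa using hHV _ (hL y hy)⟩

end IsLinearTop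

section SeriesTopology

variable {F : Type u} [Field F] {O : ValuationSubring F} {π : O}
  {s : IsLocalRing.ResidueField O →+* O} {σ : TopologicalSpace (IsLocalRing.ResidueField O)}

/-- The basic set attached to a sequence of subgroups, when the lifting is a coefficient field. -/
noncomputable def basicSubgroup (hO : IsCompleteDVR O) (hπ : Irreducible π)
    (hs : ∀ a, IsLocalRing.residue O (s a) = a)
    (H : ℤ → AddSubgroup (IsLocalRing.ResidueField O)) : AddSubgroup F where
  carrier := {x | ∀ i, coef O s π x i ∈ H i}
  zero_mem' i := by
    rw [coef_zero hO hπ hs]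
    exact zero_mem _
  add_mem' hx hy i := by
    rw [coef_add hO hπ hs]
    exact add_mem (hx i) (hy i)
  neg_mem' hx i := by
    rw [coef_neg hO hπ hs]
    exact neg_mem (hx i)

theorem isOpen_basicSubgroup (hO : IsCompleteDVR O) (hπ : Irreducible π)
    (hs : ∀ a, IsLocalRing.residue O (s a) = a)
    {H : ℤ → AddSubgroup (IsLocalRing.ResidueField O)}
    (hH : ∀ i, IsOpen[σ] (H i : Set (IsLocalRing.ResidueField O)))
    {i₀ : ℤ} (hi₀ : ∀ i ≥ i₀, H i = ⊤) :
    IsOpen[seriesTopology O σ s π] (basicSubgroup hO hπ hs H : Set F) := by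
  intro x hx
  refine ⟨fun i => H i, ⟨hH, fun i => zero_mem _, i₀, fun i hi => by simp [hi₀ i hi]⟩, ?_⟩
  intro y hy
  exact add_mem hx ((mem_basicSet_iff hO hπ hs).1 hy)

theorem exists_basicSubgroup (hσ : IsLinearTop σ) (hO : IsCompleteDVR O) (hπ : Irreducible π)
    (hs : ∀ a, IsLocalRing.residue O (s a) = a)
    {U : ℤ → Set (IsLocalRing.ResidueField O)} (hU : IsAdmissible σ U) :
    ∃ (H : ℤ → AddSubgroup (IsLocalRing.ResidueField O)) (i₀ : ℤ),
      (∀ i, IsOpen[σ] (H i : Set (IsLocalRing.ResidueField O))) ∧ (∀ i ≥ i₀, H i = ⊤) ∧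
        (basicSubgroup hO hπ hs H : Set F) ⊆ basicSet O s π U := by
  obtain ⟨i₀, hi₀⟩ := hU.eventually_univ
  choose H hH hHU using fun i => hσ.exists_subgroup (hU.isOpen i) (hU.zero_mem i)
  refine ⟨fun i => if i₀ ≤ i then ⊤ else H i, i₀, fun i => ?_, fun i hi => if_pos hi, ?_⟩
  · dsimp only
    split_ifs
    · exact @isOpen_univ _ σ
    · exact hH i
  · intro x hx
    rw [mem_basicSet_iff hO hπ hs]
    intro i
    have := hx i
    by_cases hi : i₀ ≤ i
    · simp [hi₀ i hi]
    · simp only [hi, if_false] at this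
      exact hHU i this

theorem IsLinearTop.seriesTopology (hσ : IsLinearTop σ) (hO : IsCompleteDVR O)
    (hπ : Irreducible π) (hs : ∀ a, IsLocalRing.residue O (s a) = a) :
    IsLinearTop (seriesTopology O σ s π) := by
  intro V
  constructor
  · intro hV x hx
    obtain ⟨U, hU, hUV⟩ := hV x hx
    obtain ⟨H, i₀, hH, hi₀, hHU⟩ := exists_basicSubgroup hσ hO hπ hs hU
    exact ⟨basicSubgroup hO hπ hs H, isOpen_basicSubgroup hO hπ hs hH hi₀,
      fun y hy => hUV y (hHU hy)⟩
  · intro hV x hx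
    obtain ⟨H, hH, hHV⟩ := hV x hx
    obtain ⟨U, hU, hUH⟩ := hH 0 (zero_mem _)
    exact ⟨U, hU, fun y hy => hHV y (by simpa using hUH y hy)⟩

end SeriesTopology

/-! ### Coefficients of the elements of `K{{t}}` -/

section Curly

variable {K F : Type u} [Field K] {OK : ValuationSubring K} {ϖ : OK}

theorem mem_curlySeries_iff (hOK : IsCompleteDVR OK) (hϖ : Irreducible ϖ) {a : ℤ → K} :
    a ∈ CurlySeries OK ↔
      (∃ N : ℤ, ∀ i, a i ∈ lat OK ϖ N) ∧ ∀ n : ℤ, ∃ m, ∀ i ≤ m, a i ∈ lat OK ϖ n := by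
  have hne := coe_ne_zero hϖ
  refine and_congr ⟨?_, ?_⟩ ?_
  · rintro ⟨d, hd, hda⟩
    obtain ⟨N, hN⟩ := exists_mem_lat hOK hϖ d⁻¹
    refine ⟨N, fun i => ?_⟩
    have := mul_mem_lat_of_mem hϖ (hda i) hN
    rwa [mul_comm, ← mul_assoc, inv_mul_cancel₀ hd, one_mul] at this
  · rintro ⟨N, hN⟩
    exact ⟨(ϖ : K) ^ (-N), zpow_ne_zero _ hne, fun i => hN i⟩
  · rw [Filter.tendsto_def]
    constructor
    · intro h n
      have := h (lat OK ϖ n) ((mem_nhds_valTopology hOK hϖ).2 ⟨n, fun y hy => by simpa using hy⟩)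
      exact Filter.mem_atBot_sets.1 this
    · intro h V hV
      obtain ⟨n, hn⟩ := (mem_nhds_valTopology hOK hϖ).1 hV
      obtain ⟨m, hm⟩ := h n
      exact Filter.mem_atBot_sets.2 ⟨m, fun i hi => by simpa using hn _ (hm i hi)⟩

/-- In a complete discrete valuation field, a series whose terms tend to zero converges. -/
theorem exists_hasSum_valTopology (hOK : IsCompleteDVR OK) (hϖ : Irreducible ϖ) {ι : Type*}
    {f : ι → K} (hf : ∀ n : ℤ, {i | f i ∉ lat OK ϖ n}.Finite) :
    ∃ x, @HasSum K ι _ (valTopology OK) f x (SummationFilter.unconditional ι) := by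
  classical
  let T : ℕ → Finset ι := fun k => (hf k).toFinset
  have hT : ∀ k i, i ∉ T k → f i ∈ lat OK ϖ k := fun k i hi => by simpa [T] using hi
  have hTs : ∀ k t, T k ⊆ t → ∑ i ∈ t, f i - ∑ i ∈ T k, f i ∈ lat OK ϖ k := by
    intro k t ht
    rw [← Finset.sum_sdiff ht, add_sub_cancel_right]
    exact AddSubgroup.sum_mem _ fun i hi => hT k i (Finset.mem_sdiff.1 hi).2
  obtain ⟨x, hx⟩ := exists_limit hOK hϖ (m := 0) (fun k => ∑ i ∈ T k, f i) (fun k => by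
    rw [zero_add]
    refine hTs k _ fun i hi => ?_
    by_contra h
    have := lat_anti hϖ (by omega) (hT _ _ h) (m := k)
    simp [T] at hi
    exact hi this)
  refine ⟨x, (hasSum_valTopology_iff hOK hϖ).2 fun n => ⟨T n.toNat, fun t ht => ?_⟩⟩
  refine lat_anti hϖ (Int.self_le_toNat n) ?_
  have h1 := sub_mem (by simpa using hx n.toNat) (hTs _ _ ht)
  simpa using h1

variable {Φ : CurlySeries OK ≃ F}

/-- The coefficient of `t ^ i` of an element of `F = K{{t}}`. -/
def cc (Φ : CurlySeries OK ≃ F) (x : F) (i : ℤ) : K := (Φ.symm x).1 i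

theorem cc_mem (x : F) : cc Φ x ∈ CurlySeries OK := (Φ.symm x).2

theorem cc_apply (a : CurlySeries OK) : cc Φ (Φ a) = a.1 := by
  funext i
  simp [cc]

theorem cc_injective {x y : F} (h : cc Φ x = cc Φ y) : x = y :=
  Φ.symm.injective (Subtype.ext h)

theorem exists_cc_eq {a : ℤ → K} (ha : a ∈ CurlySeries OK) : ∃ x, cc Φ x = a :=
  ⟨Φ ⟨a, ha⟩, cc_apply _⟩

variable [Field F] {OF : ValuationSubring F} (hOK : IsCompleteDVR OK) (hΦ : IsCurlyIso OK OF Φ)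

include hOK hΦ

theorem cc_add (x y : F) : cc Φ (x + y) = cc Φ x + cc Φ y := by
  obtain ⟨ϖ, hϖ⟩ := exists_irreducible hOK
  have hm : cc Φ x + cc Φ y ∈ CurlySeries OK := by
    have h1 := (mem_curlySeries_iff hOK hϖ).1 (cc_mem (Φ := Φ) x)
    have h2 := (mem_curlySeries_iff hOK hϖ).1 (cc_mem (Φ := Φ) y)
    obtain ⟨⟨N, hN⟩, h1⟩ := h1
    obtain ⟨⟨N', hN'⟩, h2⟩ := h2
    refine (mem_curlySeries_iff hOK hϖ).2 ⟨⟨min N N', fun i => add_mem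
      (lat_anti hϖ (min_le_left _ _) (hN i)) (lat_anti hϖ (min_le_right _ _) (hN' i))⟩, fun n => ?_⟩
    obtain ⟨m, hm⟩ := h1 n
    obtain ⟨m', hm'⟩ := h2 n
    exact ⟨min m m', fun i hi => add_mem (hm i (by omega)) (hm' i (by omega))⟩
  have := hΦ.map_add (Φ.symm x) (Φ.symm y) ⟨_, hm⟩ (fun i => rfl)
  rw [Φ.apply_symm_apply, Φ.apply_symm_apply] at this
  rw [← this, cc_apply]

/-- The additive map sending an element of `K{{t}}` to its coefficient of `t ^ i`. -/
noncomputable def ccHom (i : ℤ) : F →+ K :=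
  AddMonoidHom.mk' (fun x => cc Φ x i) fun x y => by rw [cc_add hOK hΦ]; rfl

theorem cc_zero : cc Φ 0 = 0 := funext fun i => map_zero (ccHom hOK hΦ i)

theorem cc_sub (x y : F) : cc Φ (x - y) = cc Φ x - cc Φ y :=
  funext fun i => map_sub (ccHom hOK hΦ i) x y

theorem cc_natCast_mul (n : ℕ) (x : F) (i : ℤ) : cc Φ (n * x) i = n * cc Φ x i := by
  have := map_nsmul (ccHom hOK hΦ i) n x
  simpa [ccHom] using this

theorem charZero_of_isCurlyIso [CharZero K] : CharZero F := by
  refine charZero_of_inj_zero fun n hn => ?_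
  by_contra h0
  refine one_ne_zero (α := F) (cc_injective (Φ := Φ) (funext fun i => ?_))
  have h1 := cc_natCast_mul hOK hΦ n 1 i
  rw [hn, zero_mul, cc_zero hOK hΦ, Pi.zero_apply, zero_eq_mul] at h1
  rw [cc_zero hOK hΦ]
  exact h1.resolve_left (Nat.cast_ne_zero.2 h0)

omit hOK in
theorem mem_iff_cc {x : F} : x ∈ OF ↔ ∀ i, cc Φ x i ∈ OK := by
  have := hΦ.mem_iff (Φ.symm x)
  rwa [Φ.apply_symm_apply] at this

/-- The coefficients of a product are the convergent convolution sums. -/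
theorem hasSum_cc_mul (x y : F) (i : ℤ) :
    @HasSum K ℤ _ (valTopology OK) (fun j => cc Φ x j * cc Φ y (i - j)) (cc Φ (x * y) i)
      (SummationFilter.unconditional ℤ) := by
  obtain ⟨ϖ, hϖ⟩ := exists_irreducible hOK
  obtain ⟨⟨N, hN⟩, h1⟩ := (mem_curlySeries_iff hOK hϖ).1 (cc_mem (Φ := Φ) x)
  obtain ⟨⟨N', hN'⟩, h2⟩ := (mem_curlySeries_iff hOK hϖ).1 (cc_mem (Φ := Φ) y)
  have hterm : ∀ i n : ℤ, ∃ m m', ∀ j, j ≤ m ∨ m' ≤ j →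
      cc Φ x j * cc Φ y (i - j) ∈ lat OK ϖ n := by
    intro i n
    obtain ⟨m, hm⟩ := h1 (n - N')
    obtain ⟨m', hm'⟩ := h2 (n - N)
    refine ⟨m, i - m', fun j hj => ?_⟩
    rcases hj with hj | hj
    · simpa using mul_mem_lat hϖ (hm j hj) (hN' (i - j))
    · simpa using mul_mem_lat hϖ (hN j) (hm' (i - j) (by omega))
  have hex : ∀ i, ∃ c, @HasSum K ℤ _ (valTopology OK) (fun j => cc Φ x j * cc Φ y (i - j)) c
      (SummationFilter.unconditional ℤ) := by
    intro i
    refine exists_hasSum_valTopology hOK hϖ fun n => ?_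
    obtain ⟨m, m', h⟩ := hterm i n
    refine (Set.finite_Ioo m m').subset fun j hj => ?_
    by_contra hj'
    refine hj (h j ?_)
    simp only [Set.mem_Ioo, not_and, not_lt] at hj'
    omega
  choose c hc using hex
  -- A convolution sum lies in every lattice that contains all of its terms.
  have hclat : ∀ i n, (∀ j, cc Φ x j * cc Φ y (i - j) ∈ lat OK ϖ n) → c i ∈ lat OK ϖ n := by
    intro i n h
    obtain ⟨s, hs⟩ := (hasSum_valTopology_iff hOK hϖ).1 (hc i) n
    have := add_mem (hs s subset_rfl) (AddSubgroup.sum_mem _ fun j (_ : j ∈ s) => h j)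
    simpa using this
  have hcm : c ∈ CurlySeries OK := by
    refine (mem_curlySeries_iff hOK hϖ).2 ⟨⟨N + N', fun i => hclat i _ fun j =>
      mul_mem_lat hϖ (hN j) (hN' _)⟩, fun n => ?_⟩
    obtain ⟨m, hm⟩ := h1 (n - N')
    obtain ⟨m', hm'⟩ := h2 (n - N)
    refine ⟨m + m', fun i hi => hclat i n fun j => ?_⟩
    rcases le_total j m with hj | hj
    · simpa using mul_mem_lat hϖ (hm j hj) (hN' (i - j))
    · simpa using mul_mem_lat hϖ (hN j) (hm' (i - j) (by omega))
  have := hΦ.map_mul (Φ.symm x) (Φ.symm y) ⟨c, hcm⟩ hc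
  rw [Φ.apply_symm_apply, Φ.apply_symm_apply] at this
  rw [← this, cc_apply]
  exact hc i

/-- Membership of the coefficients of a product in an open subgroup can be tested termwise. -/
theorem cc_mul_mem (hϖ : Irreducible ϖ) {x y : F} {i n : ℤ} {G : AddSubgroup K}
    (hG : lat OK ϖ n ≤ G) (h : ∀ j, cc Φ x j * cc Φ y (i - j) ∈ G) : cc Φ (x * y) i ∈ G := by
  obtain ⟨s, hs⟩ := (hasSum_valTopology_iff hOK hϖ).1 (hasSum_cc_mul hOK hΦ x y i) n
  have := add_mem (hG (hs s subset_rfl)) (AddSubgroup.sum_mem _ fun j (_ : j ∈ s) => h j)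
  simpa using this

/-- A convolution with finitely many nonzero terms is an ordinary sum. -/
theorem cc_mul_eq_sum {x y : F} {i : ℤ} (s : Finset ℤ)
    (h : ∀ j ∉ s, cc Φ x j * cc Φ y (i - j) = 0) :
    cc Φ (x * y) i = ∑ j ∈ s, cc Φ x j * cc Φ y (i - j) := by
  obtain ⟨ϖ, hϖ⟩ := exists_irreducible hOK
  refine eq_of_forall_sub_mem_lat hOK hϖ (m := 0) fun n _ => ?_
  obtain ⟨t, ht⟩ := (hasSum_valTopology_iff hOK hϖ).1 (hasSum_cc_mul hOK hΦ x y i) n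
  have := ht (t ∪ s) Finset.subset_union_left
  rwa [← Finset.sum_subset Finset.subset_union_right (fun j _ hj => h j hj)] at this

end Curly

theorem IsCanonicalLifting.isCompleteDVR {F : Type u} [Field F] {O : ValuationSubring F}
    {h : IsLocalRing.ResidueField O → O} (hh : IsCanonicalLifting O h) : IsCompleteDVR O := by
  cases hh <;> assumption

theorem IsCanonicalLifting.charZero {F : Type u} [Field F] {O : ValuationSubring F}
    {h : IsLocalRing.ResidueField O → O} (hh : IsCanonicalLifting O h) : CharZero F := by
  induction hh with
  | base => assumption
  | step OK OF hK hhK hOF Φ hΦ h hh ih => exact charZero_of_isCurlyIso hhK.isCompleteDVR hΦ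

/-! ### Higher topologies in positive characteristic -/

/-- In positive characteristic higher topologies only come from coefficient fields. -/
theorem IsHigherTopology.exists_of_charP {n p : ℕ} {k : Type u} [Field k] [CharP k p]
    (hp : p ≠ 0) {σ : TopologicalSpace k} (h : IsHigherTopology (n + 1) k σ) :
    ∃ (O : ValuationSubring k) (σ' : TopologicalSpace (IsLocalRing.ResidueField O))
      (s : IsLocalRing.ResidueField O →+* O) (π : O), IsCompleteDVR O ∧
      IsHigherTopology n (IsLocalRing.ResidueField O) σ' ∧
      (∀ a, IsLocalRing.residue O (s a) = a) ∧ Irreducible π ∧ σ = seriesTopology O σ' s π := by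
  obtain ⟨O, σ', hO, hσ', h⟩ := h
  have h0 : ¬ CharZero k := fun h0 => hp (CharP.eq k ‹_› (CharP.ofCharZero k))
  cases h with
  | equalChar s hs π hπ => exact ⟨O, σ', s, π, hO, hσ', hs, hπ, rfl⟩
  | standard h hh π hπ => exact absurd hh.charZero h0
  | finite M OM hOM hM σM hσM h hh π hπ b =>
    have := hh.charZero
    exact absurd (charZero_of_injective_algebraMap (algebraMap M k).injective) h0

theorem charP_residueField {p : ℕ} [hp : Fact p.Prime] {k : Type u} [Field k] [CharP k p]
    (O : ValuationSubring k) : CharP (IsLocalRing.ResidueField O) p := by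
  refine (CharP.charP_iff_prime_eq_zero hp.out).2 ?_
  have : ((p : ℕ) : O) = 0 := Subtype.ext (by push_cast; exact CharP.cast_eq_zero k p)
  rw [← map_natCast (IsLocalRing.residue O), this, map_zero]

theorem IsHigherTopology.isLinearTop {p : ℕ} [hp : Fact p.Prime] (n : ℕ) :
    ∀ {k : Type u} [Field k] [CharP k p] {σ : TopologicalSpace k}, IsHigherTopology n k σ →
      IsLinearTop σ := by
  induction n with
  | zero =>
    rintro k _ _ σ ⟨-, rfl⟩
    exact IsLinearTop.bot
  | succ n ih =>
    intro k _ _ σ h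
    obtain ⟨O, σ', s, π, hO, hσ', hs, hπ, rfl⟩ := h.exists_of_charP hp.out.ne_zero
    have := charP_residueField (p := p) O
    exact (ih hσ').seriesTopology hO hπ hs

/-! ### Uniqueness of the complete discrete valuation -/

section Hensel

variable {B : Type u} [Field B] {O : ValuationSubring B}

/-- A Henselian ring, of residue characteristic `p`, that maps to a complete discrete valuation
field `B` lands in the ring of integers: for `z` in the ideal, `1 + z` has roots of arbitrarily
large order prime to `p`, so that its image has valuation zero. -/
theorem map_mem_of_henselianRing {R : Type*} [CommRing R] {I : Ideal R} [HenselianRing R I]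
    {p : ℕ} [hp : Fact p.Prime] (hR : ∀ m : ℕ, IsUnit ((p * m + 1 : ℕ) : R))
    (hO : IsCompleteDVR O) (φ : R →+* B) {ϖ : R} (hϖ : ϖ ∈ I) (hϖ0 : φ ϖ ≠ 0) (y : R) :
    φ y ∈ O := by
  obtain ⟨π, hπ⟩ := exists_irreducible hO
  have hunit : ∀ z ∈ I, φ (1 + z) ∈ O := by
    intro z hz
    by_contra hu
    have hu0 : φ (1 + z) ≠ 0 := fun h => hu (h ▸ O.zero_mem)
    obtain ⟨u, e, he⟩ := exists_unit_mul_zpow hO hπ hu0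
    have he' : φ (1 + z) ∈ lat O π e := he ▸ (unit_mul_zpow_mem_lat hπ u).2 le_rfl
    -- The order of the root exceeds `|e|` and is invertible in `R`.
    set N : ℕ := p * e.natAbs + 1 with hN
    have hN1 : IsUnit (N : R) := hR _
    obtain ⟨w, hw, -⟩ := HenselianRing.is_henselian (I := I)
      (Polynomial.X ^ N - Polynomial.C (1 + z)) (Polynomial.monic_X_pow_sub_C _ (by omega)) 1
      (by simpa using neg_mem hz) (by
        have := hN1.map (Ideal.Quotient.mk I)
        rw [map_natCast] at this
        simpa [Polynomial.derivative_X_pow] using this)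
    have hw : w ^ N = 1 + z := by simpa [sub_eq_zero, Polynomial.IsRoot] using hw
    have hw0 : φ w ≠ 0 := by
      intro h
      apply hu0
      rw [← hw, map_pow, h, zero_pow (by omega)]
    obtain ⟨v, f, hf⟩ := exists_unit_mul_zpow hO hπ hw0
    have hpow : φ (1 + z) = ((v ^ N : Oˣ) : O) * (π : B) ^ (f * N) := by
      rw [← hw, map_pow, hf, mul_pow, zpow_mul, zpow_natCast]
      simp
    have h1 : e ≤ f * N := by
      rw [hpow, unit_mul_zpow_mem_lat hπ] at he'
      exact he'
    have h2 : f < 0 := by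
      by_contra! h2
      apply hu
      rw [← mem_lat_zero (π := π), hpow, unit_mul_zpow_mem_lat hπ]
      positivity
    have h3 : (e.natAbs : ℤ) < N := by
      have := Nat.le_mul_of_pos_left e.natAbs hp.out.pos
      omega
    have h4 : f * N ≤ -N := by nlinarith
    omega
  have hmul : ∀ z ∈ I, φ z ∈ O := by
    intro z hz
    have := O.sub_mem (hunit z hz) O.one_mem
    simpa using this
  by_contra hy
  have hy0 : φ y ≠ 0 := fun h => hy (h ▸ O.zero_mem)
  obtain ⟨u, e, he⟩ := exists_unit_mul_zpow hO hπ hy0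
  obtain ⟨v, f, hf⟩ := exists_unit_mul_zpow hO hπ hϖ0
  have hneg : e < 0 := by
    by_contra! h
    apply hy
    rw [← mem_lat_zero (π := π), he, unit_mul_zpow_mem_lat hπ]
    exact h
  have h1 := hmul (ϖ * y ^ (f.natAbs + 1)) (I.mul_mem_right _ hϖ)
  have h2 : φ (ϖ * y ^ (f.natAbs + 1)) =
      ((v * u ^ (f.natAbs + 1) : Oˣ) : O) * (π : B) ^ (f + e * (f.natAbs + 1 : ℕ)) := by
    rw [map_mul, map_pow, hf, he, mul_pow, zpow_add₀ (coe_ne_zero hπ), zpow_mul, zpow_natCast]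
    simp
    ring
  rw [← mem_lat_zero (π := π), h2, unit_mul_zpow_mem_lat hπ] at h1
  push_cast at h1
  have h3 : e * (|f| + 1) ≤ -(|f| + 1) := by nlinarith [abs_nonneg f]
  have := le_abs_self f
  omega

theorem ne_top (hO : IsCompleteDVR O) : O ≠ ⊤ := by
  obtain ⟨π, hπ⟩ := exists_irreducible hO
  intro h
  have h1 : (π : B)⁻¹ ∈ O := h.ge (ValuationSubring.mem_top _)
  exact hπ.not_isUnit (IsUnit.of_mul_eq_one ⟨_, h1⟩
    (Subtype.ext (mul_inv_cancel₀ (coe_ne_zero hπ))))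

theorem eq_of_le_of_ne_top (hO : IsCompleteDVR O) {O' : ValuationSubring B} (hle : O ≤ O')
    (hne : O' ≠ ⊤) : O = O' := by
  have := hO.dvr
  have : Ring.KrullDimLE 1 O := inferInstance
  exact O.eq_of_le_of_ne_top hle hne

end Hensel

section Extensions

variable {k A : Type u} [Field k] [Field A] {Ok : ValuationSubring k} {OA : ValuationSubring A}
  {α : k →+* A}

/-- The ring of integers of a complete discrete valuation field of characteristic `p` is determined
by the field, and is compatible with finite extensions. -/
theorem map_mem_iff {p : ℕ} [Fact p.Prime] [CharP k p] (hk : IsCompleteDVR Ok)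
    (hA : IsCompleteDVR OA) (hα : α.Finite) (x : k) : α x ∈ OA ↔ x ∈ Ok := by
  have hle : Ok ≤ OA.comap α := by
    intro x hx
    obtain ⟨π, hπ⟩ := exists_irreducible hk
    have := hk.complete
    have := hk.dvr
    have : CharP Ok p := ((algebraMap Ok k).charP_iff Subtype.val_injective p).2 ‹_›
    exact map_mem_of_henselianRing (I := IsLocalRing.maximalIdeal Ok) (p := p)
      (fun m => by simp) hA
      (α.comp (algebraMap Ok k)) (hπ.maximalIdeal_eq ▸ Ideal.mem_span_singleton_self π)
      ((map_ne_zero α).2 (coe_ne_zero hπ)) ⟨x, hx⟩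
  have hne : OA.comap α ≠ ⊤ := by
    intro htop
    have hmem : ∀ x, α x ∈ OA := fun x => by
      have : x ∈ OA.comap α := htop ▸ ValuationSubring.mem_top x
      exact this
    refine ne_top hA (eq_top_iff.2 fun y _ => ?_)
    let α' : k →+* OA := α.codRestrict OA.toSubring hmem
    obtain ⟨P, hP, hPy⟩ := hα.to_isIntegral y
    have : IsIntegral OA y := by
      refine ⟨P.map α', hP.map _, ?_⟩
      rw [Polynomial.eval₂_map]
      exact hPy
    obtain ⟨z, hz⟩ := IsIntegrallyClosed.isIntegral_iff.1 this
    exact hz ▸ z.2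
  have := eq_of_le_of_ne_top hk hle hne
  rw [this]
  rfl

/-! ### Finite extensions of complete discrete valuation fields -/

variable {πk : Ok} {πA : OA}

theorem map_uniformizer (hA : IsCompleteDVR OA) (hπk : Irreducible πk) (hπA : Irreducible πA)
    (hc : ∀ x, α x ∈ OA ↔ x ∈ Ok) :
    ∃ (u : OAˣ) (e : ℤ), 0 < e ∧ α πk = (u : OA) * (πA : A) ^ e := by
  have hne := coe_ne_zero hπk
  obtain ⟨u, e, he⟩ := exists_unit_mul_zpow hA hπA ((map_ne_zero α).2 hne)
  refine ⟨u, e, ?_, he⟩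
  by_contra! hle
  have h1 : (πk : k)⁻¹ ∈ Ok := by
    have h2 : ((u⁻¹ : OAˣ) : OA).1 * ((u : OA) : A) = 1 := congrArg Subtype.val (Units.inv_mul u)
    rw [← hc, map_inv₀, he, mul_inv, ← eq_inv_of_mul_eq_one_left h2, ← zpow_neg,
      ← mem_lat_zero (π := πA), unit_mul_zpow_mem_lat hπA]
    omega
  exact hπk.not_isUnit (IsUnit.of_mul_eq_one ⟨_, h1⟩ (Subtype.ext (mul_inv_cancel₀ hne)))

theorem map_mem_lat (hA : IsCompleteDVR OA) (hπk : Irreducible πk) (hπA : Irreducible πA)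
    (hc : ∀ x, α x ∈ OA ↔ x ∈ Ok) {n : ℤ} (hn : 0 ≤ n) {x : k} (hx : x ∈ lat Ok πk n) :
    α x ∈ lat OA πA n := by
  obtain ⟨u, e, he, h⟩ := map_uniformizer hA hπk hπA hc
  have h1 : α ((πk : k) ^ (-n) * x) ∈ OA := (hc _).2 hx
  have h2 : α ((πk : k) ^ n) ∈ lat OA πA n := by
    lift n to ℕ using hn
    rw [zpow_natCast, map_pow]
    have h3 : α πk ∈ lat OA πA 1 := by
      rw [h, unit_mul_zpow_mem_lat hπA]
      omega
    simpa using pow_mem_lat hπA h3 n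
  have h3 := mul_mem_lat_of_mem hπA h1 h2
  rwa [← map_mul, mul_right_comm, ← zpow_add₀ (coe_ne_zero hπk), neg_add_cancel, zpow_zero,
    one_mul] at h3

/-- A family that generates `OA` over `Ok` modulo the uniformizer generates it. -/
theorem exists_coordinates_of_mod (hk : IsCompleteDVR Ok) (hA : IsCompleteDVR OA)
    (hπk : Irreducible πk) (hc : ∀ x, α x ∈ OA ↔ x ∈ Ok) {ι : Type*} [Fintype ι] {w : ι → A}
    (hw : ∀ i, w i ∈ OA)
    (happ : ∀ x ∈ OA, ∃ c : ι → k, (∀ i, c i ∈ Ok) ∧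
      ∃ z ∈ OA, x = ∑ i, α (c i) * w i + α πk * z) :
    ∀ x ∈ OA, ∃ c : ι → k, (∀ i, c i ∈ Ok) ∧ x = ∑ i, α (c i) * w i := by
  obtain ⟨πA, hπA⟩ := exists_irreducible hA
  intro x hx
  choose! C hC Z hZ hCZ using happ
  let X : ℕ → A := fun n => Z^[n] x
  have hX : ∀ n, X n ∈ OA := by
    intro n
    induction n with
    | zero => exact hx
    | succ n ih =>
      simp only [X, Function.iterate_succ_apply']
      exact hZ _ ih
  let S : ι → ℕ → k := fun i n => ∑ j ∈ Finset.range n, (πk : k) ^ j * C (X j) i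
  have hS : ∀ n, x = ∑ i, α (S i n) * w i + α πk ^ n * X n := by
    intro n
    induction n with
    | zero => simp [S, X]
    | succ n ih =>
      have h1 : X n = ∑ i, α (C (X n) i) * w i + α πk * X (n + 1) := by
        simp only [X, Function.iterate_succ_apply']
        exact hCZ _ (hX n)
      simp only [S, Finset.sum_range_succ, map_add, add_mul, Finset.sum_add_distrib]
      rw [ih, pow_succ, mul_assoc, add_assoc]
      congr 1
      conv_lhs => rw [h1]
      rw [mul_add, Finset.mul_sum]
      simp [mul_assoc]
  have hlim : ∀ i, ∃ c, ∀ n : ℕ, c - S i n ∈ lat Ok πk (0 + n) := fun i =>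
    exists_limit hk hπk (S i) fun n => by
      simp only [S, Finset.sum_range_succ, add_sub_cancel_left, zero_add]
      rw [← zpow_natCast]
      exact zpow_mul_mem_lat hπk (hC _ (hX n) i)
  choose c hc' using hlim
  refine ⟨c, fun i => ?_, ?_⟩
  · have := hc' i 0
    simpa [S, mem_lat_zero] using this
  · refine eq_of_forall_sub_mem_lat hA hπA (m := 0) fun n hn => ?_
    lift n to ℕ using hn
    have h1 : x - ∑ i, α (c i) * w i = α πk ^ n * X n - ∑ i, α (c i - S i n) * w i := by
      conv_lhs => rw [hS n]
      simp only [map_sub, sub_mul, Finset.sum_sub_distrib]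
      ring
    rw [h1]
    refine sub_mem ?_ (AddSubgroup.sum_mem _ fun i _ => ?_)
    · rw [mul_comm, ← map_pow]
      exact mul_mem_lat_of_mem hπA (hX n) (map_mem_lat hA hπk hπA hc (by omega)
        (by simpa using zpow_mem_lat hπk (n : ℤ)))
    · rw [mul_comm]
      refine mul_mem_lat_of_mem hπA (hw i) (map_mem_lat hA hπk hπA hc (by omega) ?_)
      simpa using hc' i n

/-- The integers of a finite extension form a finitely generated module. -/
theorem exists_generators (hk : IsCompleteDVR Ok) (hA : IsCompleteDVR OA) (hα : α.Finite)
    (hc : ∀ x, α x ∈ OA ↔ x ∈ Ok) : ∃ (f : ℕ) (w : Fin f → A), (∀ i, w i ∈ OA) ∧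
      ∀ x ∈ OA, ∃ c : Fin f → k, (∀ i, c i ∈ Ok) ∧ x = ∑ i, α (c i) * w i := by
  obtain ⟨π, hπ⟩ := exists_irreducible hk
  have hne := coe_ne_zero hπ
  let _ := α.toAlgebra
  have : Module.Finite k A := hα
  -- Families of integers that are linearly independent modulo the uniformizer of `k`.
  let Indep : (f : ℕ) → (Fin f → A) → Prop := fun f w => (∀ i, w i ∈ OA) ∧
    ∀ c : Fin f → k, (∀ i, c i ∈ Ok) → (∃ z ∈ OA, ∑ i, α (c i) * w i = α π * z) →
      ∀ i, c i ∈ lat Ok π 1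
  have hle : ∀ f, (∃ w, Indep f w) → f ≤ Module.finrank k A := by
    rintro f ⟨w, hw, hind⟩
    have hli : LinearIndependent k w := by
      rw [Fintype.linearIndependent_iff]
      intro g hg
      have hg' : ∑ i, α (g i) * w i = 0 := by
        simp only [Algebra.smul_def] at hg
        exact hg
      obtain ⟨N, hN⟩ : ∃ N : ℤ, ∀ i, g i ∈ lat Ok π N := by
        choose N hN using fun i => exists_mem_lat hk hπ (g i)
        obtain ⟨M, hM⟩ := (Set.finite_range N).bddBelow
        exact ⟨M, fun i => lat_anti hπ (hM ⟨i, rfl⟩) (hN i)⟩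
      have key : ∀ m : ℕ, ∀ i, g i ∈ lat Ok π (N + m) := by
        intro m
        induction m with
        | zero => simpa using hN
        | succ m ih =>
          intro i
          have h1 := hind (fun i => (π : k) ^ (-(N + m)) * g i) (fun i => ih i)
            ⟨0, OA.zero_mem, by simp [mul_assoc, ← Finset.mul_sum, hg']⟩ i
          rw [← zpow_mul_mem_lat_iff hπ (m := N + m), ← mul_assoc, ← zpow_add₀ hne] at h1
          simpa [add_assoc] using h1
      intro i
      refine eq_zero_of_forall_mem_lat hk hπ fun n => ?_
      refine lat_anti hπ ?_ (key (n - N).toNat i)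
      have := Int.self_le_toNat (n - N)
      omega
    simpa using hli.fintype_card_le_finrank
  classical
  have h0 : ∃ w, Indep 0 w := ⟨Fin.elim0, fun i => i.elim0, fun _ _ _ i => i.elim0⟩
  set f := Nat.findGreatest (fun f => ∃ w, Indep f w) (Module.finrank k A) with hf
  obtain ⟨w, hw, hind⟩ : ∃ w, Indep f w :=
    Nat.findGreatest_spec (P := fun f => ∃ w, Indep f w) (Nat.zero_le _) h0
  refine ⟨f, w, hw, exists_coordinates_of_mod hk hA hπ hc hw fun x hx => ?_⟩
  have hnot : ¬ Indep (f + 1) (Fin.cons x w) := fun h => by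
    have h1 := hle _ ⟨_, h⟩
    have := Nat.le_findGreatest (P := fun f => ∃ w, Indep f w) h1 ⟨_, h⟩
    omega
  simp only [Indep, not_and, not_forall] at hnot
  obtain ⟨c, hcO, ⟨z, hz, hcz⟩, i, hi⟩ := hnot (fun i => by
    refine Fin.cases ?_ ?_ i
    · simpa
    · simpa using hw)
  rw [Fin.sum_univ_succ] at hcz
  simp only [Fin.cons_zero, Fin.cons_succ] at hcz
  have hc0 : c 0 ∉ lat Ok π 1 := by
    intro h0
    have h1 : α ((π : k) ^ (-1 : ℤ) * c 0) ∈ OA := (hc _).2 h0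
    have h2 := hind (fun i => c i.succ) (fun i => hcO _)
      ⟨z - α ((π : k) ^ (-1 : ℤ) * c 0) * x, OA.sub_mem hz (OA.mul_mem _ _ h1 hx), by
        rw [mul_sub, ← hcz, ← mul_assoc, ← map_mul, ← mul_assoc]
        simp [hne]⟩
    revert hi
    refine Fin.cases (fun hi => hi h0) (fun i hi => hi (h2 i)) i
  have hc0' : c 0 ≠ 0 := fun h => hc0 (h ▸ zero_mem _)
  have hinv : (c 0)⁻¹ ∈ Ok := by
    obtain ⟨u, n, hn⟩ := exists_unit_mul_zpow hk hπ hc0'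
    have h1 : n < 1 := by
      by_contra! h1
      rw [hn, unit_mul_zpow_mem_lat hπ] at hc0
      exact hc0 h1
    have h2 : ((u⁻¹ : Okˣ) : Ok).1 * ((u : Ok) : k) = 1 := congrArg Subtype.val (Units.inv_mul u)
    rw [hn, mul_inv, ← eq_inv_of_mul_eq_one_left h2, ← zpow_neg, ← mem_lat_zero (π := π),
      unit_mul_zpow_mem_lat hπ]
    omega
  refine ⟨fun i => -(c 0)⁻¹ * c i.succ, fun i => Ok.mul_mem _ _ (Ok.neg_mem _ hinv) (hcO _),
    α (c 0)⁻¹ * z, OA.mul_mem _ _ ((hc _).2 hinv) hz, ?_⟩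
  have h1 : x = α (c 0)⁻¹ * (α (c 0) * x) := by
    rw [← mul_assoc, ← map_mul, inv_mul_cancel₀ hc0', map_one, one_mul]
  rw [h1, eq_sub_of_add_eq hcz, mul_sub, Finset.mul_sum]
  simp only [map_mul, map_neg, neg_mul, Finset.sum_neg_distrib, mul_assoc]
  ring

end Extensions

/-! ### Residue extensions -/

theorem _root_.RingHom.Finite.exists_generators {R S : Type*} [CommRing R] [CommRing S]
    {φ : R →+* S} (hφ : φ.Finite) :
    ∃ (m : ℕ) (g : Fin m → S), ∀ x, ∃ c : Fin m → R, x = ∑ i, φ (c i) * g i := by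
  let _ := φ.toAlgebra
  have : Module.Finite R S := hφ
  obtain ⟨m, g, hg⟩ := Module.Finite.exists_fin (R := R) (M := S)
  refine ⟨m, g, fun x => ?_⟩
  have hx : x ∈ Submodule.span R (Set.range g) := hg ▸ Submodule.mem_top
  obtain ⟨c, hc⟩ := (Submodule.mem_span_range_iff_exists_fun R).1 hx
  exact ⟨c, hc.symm⟩

theorem finite_of_generators {R S : Type*} [CommRing R] [CommRing S] {φ : R →+* S} {ι : Type*}
    [Fintype ι] {g : ι → S} (hg : ∀ x, ∃ c : ι → R, x = ∑ i, φ (c i) * g i) : φ.Finite := by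
  let _ := φ.toAlgebra
  refine Module.Finite.of_fg_top ⟨(Set.finite_range g).toFinset, ?_⟩
  rw [Set.Finite.coe_toFinset, eq_top_iff]
  rintro x -
  obtain ⟨c, hc⟩ := hg x
  exact (Submodule.mem_span_range_iff_exists_fun R).2 ⟨c, hc.symm⟩

theorem coe_unit_zpow {A : Type u} [Field A] {O : ValuationSubring A} (u : Oˣ) (j : ℤ) :
    (((u ^ j : Oˣ) : O) : A) = ((u : O) : A) ^ j := by
  have := congrArg Units.val (map_zpow (Units.map (O.subtype : O →* A)) u j)
  rw [Units.val_zpow_eq_zpow_val] at this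
  exact this

section Residue

variable {k A : Type u} [Field k] [Field A] {Ok : ValuationSubring k} {OA : ValuationSubring A}
  {α : k →+* A}

/-- The map of rings of integers induced by an extension of valued fields. -/
def integerMap (hc : ∀ x, α x ∈ OA ↔ x ∈ Ok) : Ok →+* OA :=
  (α.comp Ok.subtype).codRestrict OA.toSubring fun x => (hc x).2 x.2

theorem coe_integerMap (hc : ∀ x, α x ∈ OA ↔ x ∈ Ok) (x : Ok) :
    (integerMap hc x : A) = α x := rfl

theorem isLocalHom_integerMap (hc : ∀ x, α x ∈ OA ↔ x ∈ Ok) : IsLocalHom (integerMap hc) := by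
  refine ⟨fun a ha => ?_⟩
  obtain ⟨b, hb⟩ := ha.exists_right_inv
  have h1 : α a * b = 1 := congrArg Subtype.val hb
  have ha0 : (a : k) ≠ 0 := by
    rintro h
    simp [h] at h1
  have h2 : (a : k)⁻¹ ∈ Ok := by
    rw [← hc, map_inv₀, ← eq_inv_of_mul_eq_one_right h1]
    exact b.2
  exact IsUnit.of_mul_eq_one ⟨_, h2⟩ (Subtype.ext (mul_inv_cancel₀ ha0))

/-- The map of residue fields induced by an extension of valued fields. -/
noncomputable def residueMap (hc : ∀ x, α x ∈ OA ↔ x ∈ Ok) :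
    IsLocalRing.ResidueField Ok →+* IsLocalRing.ResidueField OA :=
  haveI := isLocalHom_integerMap hc
  IsLocalRing.ResidueField.map (integerMap hc)

theorem residueMap_residue (hc : ∀ x, α x ∈ OA ↔ x ∈ Ok) (x : Ok) :
    residueMap hc (IsLocalRing.residue Ok x) = IsLocalRing.residue OA (integerMap hc x) := rfl

theorem residueMap_finite (hk : IsCompleteDVR Ok) (hA : IsCompleteDVR OA) (hα : α.Finite)
    (hc : ∀ x, α x ∈ OA ↔ x ∈ Ok) : (residueMap hc).Finite := by
  obtain ⟨f, w, hw, hgen⟩ := exists_generators hk hA hα hc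
  refine finite_of_generators (g := fun i => IsLocalRing.residue OA ⟨w i, hw i⟩) fun x => ?_
  obtain ⟨x, rfl⟩ := IsLocalRing.residue_surjective x
  obtain ⟨c, hcO, hx⟩ := hgen x x.2
  refine ⟨fun i => IsLocalRing.residue Ok ⟨c i, hcO i⟩, ?_⟩
  have hx' : x = ∑ i, integerMap hc ⟨c i, hcO i⟩ * ⟨w i, hw i⟩ := by
    refine Subtype.ext ?_
    rw [hx]
    push_cast
    rfl
  rw [hx', map_sum]
  exact Finset.sum_congr rfl fun i _ => map_mul _ _ _

variable {B : Type u} [Field B] {OB : ValuationSubring B} {β : k →+* B} {πA : OA} {πB : OB}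

/-- Semilinear maps between finite extensions are bounded, hence continuous, for the valuation
topologies. -/
theorem exists_map_lat_le (hk : IsCompleteDVR Ok) (hA : IsCompleteDVR OA) (hB : IsCompleteDVR OB)
    (hα : α.Finite) (hcA : ∀ x, α x ∈ OA ↔ x ∈ Ok) (hcB : ∀ x, β x ∈ OB ↔ x ∈ Ok)
    (hπA : Irreducible πA) (hπB : Irreducible πB) (L : A →+ B)
    (hL : ∀ c a, L (α c * a) = β c * L a) :
    (∀ i : ℤ, ∃ q : ℤ, ∀ x ∈ lat OA πA i, L x ∈ lat OB πB q) ∧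
      ∀ q : ℤ, ∃ i : ℤ, ∀ x ∈ lat OA πA i, L x ∈ lat OB πB q := by
  obtain ⟨π, hπ⟩ := exists_irreducible hk
  obtain ⟨f, w, hw, hgen⟩ := exists_generators hk hA hα hcA
  obtain ⟨N, hN⟩ : ∃ N : ℤ, ∀ i, L (w i) ∈ lat OB πB N := by
    choose N hN using fun i => exists_mem_lat hB hπB (L (w i))
    obtain ⟨M, hM⟩ := (Set.finite_range N).bddBelow
    exact ⟨M, fun i => lat_anti hπB (hM ⟨i, rfl⟩) (hN i)⟩
  have hO : ∀ x ∈ OA, L x ∈ lat OB πB N := by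
    intro x hx
    obtain ⟨c, hcO, rfl⟩ := hgen x hx
    rw [map_sum]
    refine AddSubgroup.sum_mem _ fun i _ => ?_
    rw [hL]
    exact mul_mem_lat_of_mem hπB ((hcB _).2 (hcO i)) (hN i)
  obtain ⟨u, e, he, hu⟩ := map_uniformizer hA hπ hπA hcA
  obtain ⟨v, e', he', hv⟩ := map_uniformizer hB hπ hπB hcB
  have hscale : ∀ (j : ℤ) (x), x ∈ lat OA πA (e * j) → L x ∈ lat OB πB (e' * j + N) := by
    intro j x hx
    have hne := (map_ne_zero α).2 (coe_ne_zero hπ)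
    have h1 : α ((π : k) ^ (-j)) * x ∈ OA := by
      have h2 : α ((π : k) ^ (-j)) = ((u ^ (-j) : OAˣ) : OA) * (πA : A) ^ (-(e * j)) := by
        rw [map_zpow₀, hu, mul_zpow, ← zpow_mul, mul_neg, coe_unit_zpow]
      rw [h2, mul_assoc]
      exact OA.mul_mem _ _ (Subtype.prop _) hx
    have h3 : x = α ((π : k) ^ j) * (α ((π : k) ^ (-j)) * x) := by
      rw [← mul_assoc, ← map_mul, ← zpow_add₀ (coe_ne_zero hπ)]
      simp
    rw [h3, hL]
    refine mul_mem_lat hπB ?_ (hO _ h1)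
    have h2 : β ((π : k) ^ j) = ((v ^ j : OBˣ) : OB) * (πB : B) ^ (e' * j) := by
      rw [map_zpow₀, hv, mul_zpow, ← zpow_mul, coe_unit_zpow]
    rw [h2, unit_mul_zpow_mem_lat hπB]
  refine ⟨fun i => ⟨e' * (-|i|) + N, fun x hx => hscale _ _ (lat_anti hπA ?_ hx)⟩,
    fun q => ⟨e * |q - N|, fun x hx => lat_anti hπB ?_ (hscale _ _ hx)⟩⟩
  · have := neg_abs_le i
    nlinarith [abs_nonneg i]
  · have := le_abs_self (q - N)
    nlinarith [abs_nonneg (q - N)]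

end Residue

/-! ### Finiteness of the Frobenius -/

/-- Local fields of characteristic `p` have finite degree over the subfield of `p`-th powers. -/
theorem IsHigherTopology.frobenius_finite {p : ℕ} [hp : Fact p.Prime] (n : ℕ) :
    ∀ {k : Type u} [Field k] [CharP k p] {σ : TopologicalSpace k}, IsHigherTopology n k σ →
      (frobenius k p).Finite := by
  induction n with
  | zero =>
    rintro k _ _ σ ⟨hfin, -⟩
    exact RingHom.Finite.of_surjective _
      (Finite.injective_iff_surjective.1 (frobenius_inj k p))
  | succ n ih =>
    intro k _ _ σ h
    obtain ⟨O, σ', s, π, hO, hσ', hs, hπ, -⟩ := h.exists_of_charP hp.out.ne_zero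
    have := charP_residueField (p := p) O
    have hne := coe_ne_zero hπ
    have hfin := ih hσ'
    have hc : ∀ x, frobenius k p x ∈ O ↔ x ∈ O := by
      intro x
      rw [frobenius_def]
      refine ⟨fun h => ?_, fun h => O.toSubring.pow_mem h p⟩
      rcases O.mem_or_inv_mem x with hx | hx
      · exact hx
      · have h1 := O.mul_mem _ _ h (O.toSubring.pow_mem hx (p - 1))
        by_cases hx0 : x = 0
        · exact hx0 ▸ O.zero_mem
        · have h2 : x ^ p * x⁻¹ ^ (p - 1) = x := by
            obtain ⟨q, rfl⟩ := Nat.exists_eq_add_of_le' hp.out.one_le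
            rw [inv_pow, Nat.add_sub_cancel, pow_succ]
            field_simp
          rwa [h2] at h1
    obtain ⟨m, g, hg⟩ := hfin.exists_generators
    -- Modulo `π`, every integer is a combination of lifts of the generators, with `p`-th powers as
    -- coefficients; iterating, one obtains generators modulo the `p`-th power of `π`.
    have hstep : ∀ x ∈ O, ∃ y : Fin m → k, (∀ i, y i ∈ O) ∧ ∃ z ∈ O,
        x = ∑ i, y i ^ p * s (g i) + π * z := by
      intro x hx
      obtain ⟨c, hc⟩ := hg (IsLocalRing.residue O ⟨x, hx⟩)
      refine ⟨fun i => s (c i), fun i => (s (c i)).2, ?_⟩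
      have h1 : IsLocalRing.residue O ⟨x, hx⟩ =
          IsLocalRing.residue O (∑ i, s (c i) ^ p * s (g i)) := by
        rw [hc]
        simp [hs, frobenius_def]
      rw [residue_eq_iff_sub_mem_lat hO hπ, mem_lat] at h1
      refine ⟨_, h1, ?_⟩
      push_cast
      rw [zpow_neg_one, mul_inv_cancel_left₀ hne]
      ring
    have hiter : ∀ r : ℕ, ∀ x ∈ O, ∃ y : ℕ → Fin m → k, (∀ j i, y j i ∈ O) ∧ ∃ z ∈ O,
        x = ∑ j ∈ Finset.range r, ∑ i, y j i ^ p * (s (g i) * (π : k) ^ j) + (π : k) ^ r * z := by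
      intro r
      induction r with
      | zero => exact fun x hx => ⟨fun _ _ => 0, fun _ _ => O.zero_mem, x, hx, by simp⟩
      | succ r ihr =>
        intro x hx
        obtain ⟨y, hy, z, hz, hxz⟩ := ihr x hx
        obtain ⟨y', hy', z', hz', hzz'⟩ := hstep z hz
        refine ⟨Function.update y r y', fun j i => ?_, z', hz', ?_⟩
        · by_cases hj : j = r
          · subst hj
            simpa using hy' i
          · simpa [hj] using hy j i
        · rw [Finset.sum_range_succ, Function.update_self]
          have h1 : ∑ j ∈ Finset.range r, ∑ i, Function.update y r y' j i ^ p *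
              (s (g i) * (π : k) ^ j) = ∑ j ∈ Finset.range r, ∑ i, y j i ^ p *
              (s (g i) * (π : k) ^ j) := Finset.sum_congr rfl fun j hj => by
            rw [Function.update_of_ne (Finset.mem_range.1 hj).ne]
          rw [h1]
          conv_lhs => rw [hxz, hzz']
          rw [mul_add, Finset.mul_sum, pow_succ, add_assoc, mul_assoc]
          congr 2
          exact Finset.sum_congr rfl fun i _ => by ring
    have hgen := exists_coordinates_of_mod hO hO hπ hc
      (w := fun ij : Fin p × Fin m => (s (g ij.2) : k) * (π : k) ^ (ij.1 : ℕ))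
      (fun ij => O.mul_mem _ _ (s (g ij.2)).2 (O.toSubring.pow_mem π.2 _)) (fun x hx => by
        obtain ⟨y, hy, z, hz, hxz⟩ := hiter p x hx
        refine ⟨fun ij => y ij.1 ij.2, fun ij => hy _ _, z, hz, ?_⟩
        rw [hxz, Fintype.sum_prod_type, Finset.sum_range]
        rfl)
    refine finite_of_generators
      (g := fun ij : Fin p × Fin m => (s (g ij.2) : k) * (π : k) ^ (ij.1 : ℕ)) fun x => ?_
    obtain ⟨n, hn⟩ := exists_mem_lat hO hπ x
    have h1 : (π : k) ^ ((p * n.natAbs : ℕ) : ℤ) * x ∈ O := by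
      have h2 := mul_mem_lat hπ (zpow_mem_lat hπ ((p * n.natAbs : ℕ) : ℤ)) hn
      refine mem_of_mem_lat hπ ?_ h2
      have := Nat.le_mul_of_pos_left n.natAbs hp.out.pos
      omega
    obtain ⟨c, -, hx⟩ := hgen _ h1
    refine ⟨fun ij => ((π : k) ^ n.natAbs)⁻¹ * c ij, ?_⟩
    simp only [map_mul, mul_assoc, ← Finset.mul_sum]
    simp only [← mul_assoc] at hx ⊢
    rw [← hx, frobenius_def, inv_pow, ← pow_mul, zpow_natCast, mul_comm n.natAbs,
      inv_mul_cancel_left₀ (pow_ne_zero _ hne)]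

theorem iterateFrobenius_finite {R : Type*} [CommRing R] {p : ℕ} [ExpChar R p]
    (h : (frobenius R p).Finite) (r : ℕ) : (iterateFrobenius R p r).Finite := by
  induction r with
  | zero => exact RingHom.Finite.of_surjective _ fun x => ⟨x, by simp⟩
  | succ r ih =>
    have h1 : iterateFrobenius R p (r + 1) = (iterateFrobenius R p r).comp (frobenius R p) := by
      ext x
      simp [iterateFrobenius_def, frobenius_def, pow_succ', pow_mul]
    exact h1 ▸ ih.comp h

/-! ### Continuity of semilinear maps in positive characteristic -/

section Semilinear

variable {A B : Type u} [Field A] [Field B] {OA : ValuationSubring A} {OB : ValuationSubring B}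
  {πA : OA} {πB : OB} {sA : IsLocalRing.ResidueField OA →+* OA}
  {sB : IsLocalRing.ResidueField OB →+* OB}

/-- The map sending an element `a` of the residue field to the coefficient of `πB ^ q` in
`L (sA a * πA ^ i)`. -/
noncomputable def coefHom (sA : IsLocalRing.ResidueField OA →+* OA) (πA : OA)
    (hB : IsCompleteDVR OB) (hπB : Irreducible πB)
    (hsB : ∀ a, IsLocalRing.residue OB (sB a) = a) (L : A →+ B) (i q : ℤ) :
    IsLocalRing.ResidueField OA →+ IsLocalRing.ResidueField OB :=
  AddMonoidHom.mk' (fun a => coef OB sB πB (L (sA a * (πA : A) ^ i)) q) fun a b => by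
    rw [map_add, AddMemClass.coe_add, add_mul, map_add, coef_add hB hπB hsB]
    rfl

/-- Continuity of an additive map can be tested on coefficients. -/
theorem continuous_of_coefHom {σA : TopologicalSpace (IsLocalRing.ResidueField OA)}
    {σB : TopologicalSpace (IsLocalRing.ResidueField OB)} (hσA : IsLinearTop σA)
    (hσB : IsLinearTop σB) (hA : IsCompleteDVR OA) (hπA : Irreducible πA)
    (hsA : ∀ a, IsLocalRing.residue OA (sA a) = a) (hB : IsCompleteDVR OB)
    (hπB : Irreducible πB) (hsB : ∀ a, IsLocalRing.residue OB (sB a) = a) (L : A →+ B)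
    (hbd : ∀ i : ℤ, ∃ q : ℤ, ∀ x ∈ lat OA πA i, L x ∈ lat OB πB q)
    (hcont : ∀ q : ℤ, ∃ i : ℤ, ∀ x ∈ lat OA πA i, L x ∈ lat OB πB q)
    (hD : ∀ i q, @Continuous _ _ σA σB (coefHom sA πA hB hπB hsB L i q)) :
    @Continuous A B (seriesTopology OA σA sA πA) (seriesTopology OB σB sB πB) L := by
  refine (hσA.seriesTopology hA hπA hsA).continuous_of (hσB.seriesTopology hB hπB hsB) L
    fun H hH => ?_
  obtain ⟨U, hU, hUH⟩ := hH 0 (zero_mem _)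
  obtain ⟨V, q₀, hV, hq₀, hVU⟩ := exists_basicSubgroup hσB hB hπB hsB hU
  have hVH : ∀ x, (∀ q, coef OB sB πB x q ∈ V q) → x ∈ H := fun x hx => by
    simpa using hUH x (hVU hx)
  obtain ⟨i₁, hi₁⟩ := hcont q₀
  -- The condition imposed on the `i`-th coefficient involves only finitely many `q`.
  choose q₁ hq₁ using hbd
  let W : ℤ → AddSubgroup (IsLocalRing.ResidueField OA) := fun i =>
    if i₁ ≤ i then ⊤ else
      ⨅ q ∈ Finset.Ico (q₁ i) q₀, (V q).comap (coefHom sA πA hB hπB hsB L i q)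
  have hW : ∀ i, IsOpen[σA] (W i : Set (IsLocalRing.ResidueField OA)) := by
    intro i
    by_cases hi : i₁ ≤ i
    · simp only [W, hi, if_true]
      exact @isOpen_univ _ σA
    · simp only [W, hi, if_false, AddSubgroup.coe_iInf]
      exact @isOpen_biInter_finset _ _ σA _ _ fun q _ =>
        @IsOpen.preimage _ _ σA σB _ (hD i q) _ (hV q)
  refine ⟨basicSubgroup hA hπA hsA W,
    isOpen_basicSubgroup hA hπA hsA hW (i₀ := i₁) fun i hi => if_pos hi, fun x hx => ?_⟩
  have hser := isSeriesSum_coef hA hπA hsA x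
  obtain ⟨m, hm⟩ := hser.1
  have htail := hser.sub_sum_mem_lat hA hπA (map_zero sA) hm i₁
  have h1 : L (x - ∑ i ∈ Finset.Ico m i₁, (sA (coef OA sA πA x i) : A) * (πA : A) ^ i) ∈ H := by
    refine hVH _ fun q => ?_
    by_cases hq : q₀ ≤ q
    · simp [hq₀ q hq]
    · rw [coef_eq_zero hB hπB hsB (hi₁ _ htail) (not_le.1 hq)]
      exact zero_mem _
  have h2 : L (∑ i ∈ Finset.Ico m i₁, (sA (coef OA sA πA x i) : A) * (πA : A) ^ i) ∈ H := by
    rw [map_sum]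
    refine AddSubgroup.sum_mem _ fun i hi => hVH _ fun q => ?_
    by_cases hq : q₀ ≤ q
    · simp [hq₀ q hq]
    · have hxi := hx i
      simp only [W, not_le.2 (Finset.mem_Ico.1 hi).2, if_false] at hxi
      by_cases hq' : q₁ i ≤ q
      · simp only [AddSubgroup.mem_iInf] at hxi
        exact hxi q (Finset.mem_Ico.2 ⟨hq', not_le.1 hq⟩)
      · rw [coef_eq_zero hB hπB hsB (hq₁ i _ (term_mem_lat hπA _ i)) (not_le.1 hq')]
        exact zero_mem _
  rw [map_sub] at h1
  simpa using add_mem h1 h2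

variable {k : Type u} [Field k] {Ok : ValuationSubring k} {α : k →+* A} {β : k →+* B}
  {p : ℕ} [hp : Fact p.Prime]

omit [Field B] in
/-- All lifts of an element of the residue field have the same `p ^ r`-th power modulo the
`p ^ r`-th power of the maximal ideal. -/
theorem lift_pow_sub_mem_lat [CharP A p] (hcA : ∀ x, α x ∈ OA ↔ x ∈ Ok) (hA : IsCompleteDVR OA)
    (hπA : Irreducible πA) (hsA : ∀ a, IsLocalRing.residue OA (sA a) = a) (c : Ok) (r : ℕ) :
    (sA (residueMap hcA (IsLocalRing.residue Ok c)) : A) ^ p ^ r - α ((c : k) ^ p ^ r) ∈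
      lat OA πA (p ^ r : ℕ) := by
  have h1 : (sA (residueMap hcA (IsLocalRing.residue Ok c)) : A) - α c ∈ lat OA πA 1 := by
    rw [residueMap_residue, ← coe_integerMap hcA, ← residue_eq_iff_sub_mem_lat hA hπA, hsA]
  have h2 := pow_mem_lat hπA h1 (p ^ r)
  rwa [sub_pow_char_pow, mul_one, ← map_pow] at h2

/-- Although `sA` is not compatible with the residue field of `k`, the coefficients of a semilinear
map are semilinear over a sufficiently high power of the Frobenius. -/
theorem exists_coefHom_semilinear [CharP A p] [CharP B p]
    (hcA : ∀ x, α x ∈ OA ↔ x ∈ Ok) (hcB : ∀ x, β x ∈ OB ↔ x ∈ Ok) (hA : IsCompleteDVR OA)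
    (hπA : Irreducible πA) (hsA : ∀ a, IsLocalRing.residue OA (sA a) = a)
    (hB : IsCompleteDVR OB) (hπB : Irreducible πB)
    (hsB : ∀ a, IsLocalRing.residue OB (sB a) = a) (L : A →+ B)
    (hL : ∀ c a, L (α c * a) = β c * L a)
    (hbd : ∀ i : ℤ, ∃ q : ℤ, ∀ x ∈ lat OA πA i, L x ∈ lat OB πB q)
    (hcont : ∀ q : ℤ, ∃ i : ℤ, ∀ x ∈ lat OA πA i, L x ∈ lat OB πB q) (i q : ℤ) :
    ∃ r : ℕ, ∀ c a, coefHom sA πA hB hπB hsB L i q (residueMap hcA (c ^ p ^ r) * a) =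
      residueMap hcB (c ^ p ^ r) * coefHom sA πA hB hπB hsB L i q a := by
  obtain ⟨q₁, hq₁⟩ := hbd i
  obtain ⟨i₁, hi₁⟩ := hcont (q + 1)
  -- The exponent is chosen so that the errors below do not affect the `q`-th coefficient.
  obtain ⟨r, hr⟩ : ∃ r : ℕ, q + 1 - q₁ ≤ (p ^ r : ℕ) ∧ i₁ - i ≤ (p ^ r : ℕ) := by
    refine ⟨(q + 1 - q₁).toNat + (i₁ - i).toNat, ?_⟩
    have := (Nat.lt_pow_self hp.out.one_lt (n := (q + 1 - q₁).toNat + (i₁ - i).toNat))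
    omega
  refine ⟨r, fun c a => ?_⟩
  obtain ⟨c, rfl⟩ := IsLocalRing.residue_surjective c
  show coef OB sB πB (L (sA (residueMap hcA _ * a) * (πA : A) ^ i)) q =
    residueMap hcB _ * coef OB sB πB (L (sA a * (πA : A) ^ i)) q
  rw [map_pow, map_pow, ← coef_mul hB hπB hsB]
  refine coef_eq_of_sub_mem_lat hB hπB hsB (n := q + 1) ?_ (by omega)
  have hA1 := lift_pow_sub_mem_lat (p := p) (πA := πA) hcA hA hπA hsA c r
  have hB1 := lift_pow_sub_mem_lat (p := p) (πA := πB) hcB hB hπB hsB c r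
  have hterm := term_mem_lat hπA (sA a) i
  have e1 : L (((sA (residueMap hcA (IsLocalRing.residue Ok c)) : A) ^ p ^ r
      - α ((c : k) ^ p ^ r)) * (sA a * (πA : A) ^ i)) ∈ lat OB πB (q + 1) :=
    hi₁ _ (lat_anti hπA (by omega) (mul_mem_lat hπA hA1 hterm))
  have e2 : ((sB (residueMap hcB (IsLocalRing.residue Ok c)) : B) ^ p ^ r
      - β ((c : k) ^ p ^ r)) * L (sA a * (πA : A) ^ i) ∈ lat OB πB (q + 1) :=
    lat_anti hπB (by omega) (mul_mem_lat hπB hB1 (hq₁ _ hterm))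
  rw [sub_mul, map_sub, hL] at e1
  convert sub_mem e1 e2 using 1
  have e3 : ((sA (residueMap hcA (IsLocalRing.residue Ok c) ^ p ^ r * a) : OA) : A) =
      (sA (residueMap hcA (IsLocalRing.residue Ok c)) : A) ^ p ^ r * sA a := by
    rw [map_mul sA, map_pow sA]
    rfl
  have e4 : ((sB (residueMap hcB (IsLocalRing.residue Ok c) ^ p ^ r) : OB) : B) =
      (sB (residueMap hcB (IsLocalRing.residue Ok c)) : B) ^ p ^ r := by
    rw [map_pow sB]
    rfl
  rw [e3, e4, mul_assoc]
  ring

end Semilinear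

/-- Let `k` be a local field of characteristic `p` and `A`, `B` finite extensions of it. Semilinear
maps from `A` to `B` are continuous for all choices of higher topologies. In particular the higher
topology of `A` is unique.

By induction on the dimension, the coefficients of such a map are continuous, because they are
semilinear over a power of the Frobenius, and the Frobenius of the residue field is finite. -/
theorem continuous_of_semilinear {p : ℕ} [hp : Fact p.Prime] (n : ℕ) :
    ∀ {k A B : Type u} [Field k] [Field A] [Field B] [CharP k p] [CharP A p] [CharP B p]
      {σk : TopologicalSpace k} {σA : TopologicalSpace A} {σB : TopologicalSpace B},
      IsHigherTopology n k σk → IsHigherTopology n A σA → IsHigherTopology n B σB →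
      ∀ {α : k →+* A} {β : k →+* B}, α.Finite → β.Finite → ∀ L : A →+ B,
        (∀ c a, L (α c * a) = β c * L a) → @Continuous A B σA σB L := by
  induction n with
  | zero =>
    rintro k A B _ _ _ _ _ _ σk _ σB - ⟨-, rfl⟩ - α β - - L -
    exact continuous_bot
  | succ n ih =>
    intro k A B _ _ _ _ _ _ σk σA σB hσk hσA hσB α β hα hβ L hL
    obtain ⟨Ok, σk', sk, πk, hk, hσk', hsk, hπk, -⟩ := hσk.exists_of_charP hp.out.ne_zero
    obtain ⟨OA, σA', sA, πA, hA, hσA', hsA, hπA, rfl⟩ := hσA.exists_of_charP hp.out.ne_zero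
    obtain ⟨OB, σB', sB, πB, hB, hσB', hsB, hπB, rfl⟩ := hσB.exists_of_charP hp.out.ne_zero
    have := charP_residueField (p := p) Ok
    have := charP_residueField (p := p) OA
    have := charP_residueField (p := p) OB
    have hcA := map_mem_iff (p := p) hk hA hα
    have hcB := map_mem_iff (p := p) hk hB hβ
    obtain ⟨hbd, hcont⟩ := exists_map_lat_le hk hA hB hα hcA hcB hπA hπB L hL
    refine continuous_of_coefHom (IsHigherTopology.isLinearTop (p := p) n hσA')
      (IsHigherTopology.isLinearTop (p := p) n hσB') hA hπA hsA hB hπB hsB L hbd hcont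
      fun i q => ?_
    obtain ⟨r, hr⟩ := exists_coefHom_semilinear (p := p) hcA hcB hA hπA hsA hB hπB hsB L hL
      hbd hcont i q
    have hfrob := iterateFrobenius_finite (IsHigherTopology.frobenius_finite (p := p) n hσk') r
    refine ih hσk' hσA' hσB' ((residueMap_finite hk hA hα hcA).comp hfrob)
      ((residueMap_finite hk hB hβ hcB).comp hfrob) _ fun c a => ?_
    simpa [iterateFrobenius_def] using hr c a

/-! ### The residue field of `K{{t}}` -/

section CurlyResidue

variable {K F : Type u} [Field K] {OK : ValuationSubring K} {ϖ : OK} {Φ : CurlySeries OK ≃ F}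

/-- The element of `F = K{{t}}` with given coefficients. -/
noncomputable def ofCoef [Nonempty F] (Φ : CurlySeries OK ≃ F) (a : ℤ → K) : F :=
  Function.invFun (cc Φ) a

theorem cc_ofCoef [Nonempty F] {a : ℤ → K} (ha : a ∈ CurlySeries OK) : cc Φ (ofCoef Φ a) = a :=
  Function.invFun_eq (exists_cc_eq ha)

theorem mem_curlySeries_of_bddBelow (hOK : IsCompleteDVR OK) (hϖ : Irreducible ϖ) {a : ℤ → K}
    {m N : ℤ} (hm : ∀ i < m, a i = 0) (hN : ∀ i, a i ∈ lat OK ϖ N) : a ∈ CurlySeries OK := by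
  refine (mem_curlySeries_iff hOK hϖ).2 ⟨⟨N, hN⟩, fun n => ⟨m - 1, fun i hi => ?_⟩⟩
  rw [hm i (by omega)]
  exact zero_mem _

variable [Field F] {OF : ValuationSubring F} (hOK : IsCompleteDVR OK) (hOF : IsCompleteDVR OF)
  (hΦ : IsCurlyIso OK OF Φ)

/-- The monomial `c * t ^ j` of `F = K{{t}}`. -/
noncomputable def mono (Φ : CurlySeries OK ≃ F) (j : ℤ) (c : K) : F := ofCoef Φ (Pi.single j c)

include hOK

theorem cc_mono (j : ℤ) (c : K) : cc Φ (mono Φ j c) = Pi.single j c := by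
  obtain ⟨ϖ, hϖ⟩ := exists_irreducible hOK
  obtain ⟨N, hN⟩ := exists_mem_lat hOK hϖ c
  refine cc_ofCoef (mem_curlySeries_of_bddBelow hOK hϖ (m := j) (N := N) (fun i hi => ?_)
    fun i => ?_)
  · exact Pi.single_eq_of_ne hi.ne _
  · by_cases h : i = j
    · subst h
      simpa using hN
    · rw [Pi.single_eq_of_ne h]
      exact zero_mem _

include hΦ

theorem cc_mono_mul (j : ℤ) (c : K) (x : F) (i : ℤ) :
    cc Φ (mono Φ j c * x) i = c * cc Φ x (i - j) := by
  rw [cc_mul_eq_sum hOK hΦ {j} (fun l hl => ?_), Finset.sum_singleton, cc_mono hOK]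
  · simp
  · rw [cc_mono hOK, Pi.single_eq_of_ne (by simpa using hl), zero_mul]

theorem mono_mul_mono (i j : ℤ) (a b : K) :
    mono Φ i a * mono Φ j b = mono Φ (i + j) (a * b) := by
  refine cc_injective (Φ := Φ) (funext fun l => ?_)
  rw [cc_mono_mul hOK hΦ, cc_mono hOK, cc_mono hOK]
  by_cases h : l = i + j
  · subst h
    simp
  · rw [Pi.single_eq_of_ne h, Pi.single_eq_of_ne (by omega), mul_zero]

theorem mono_zero_one : mono Φ 0 1 = 1 := by
  rw [← mul_one (mono Φ 0 1)]
  refine cc_injective (Φ := Φ) (funext fun l => ?_)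
  rw [cc_mono_mul hOK hΦ]
  simp

theorem mono_mem {c : K} (hc : c ∈ OK) (j : ℤ) : mono Φ j c ∈ OF := by
  rw [mem_iff_cc hΦ]
  intro i
  rw [cc_mono hOK]
  by_cases h : i = j
  · subst h
    simpa
  · rw [Pi.single_eq_of_ne h]
    exact OK.zero_mem

theorem residue_eq_zero_of_cc (hϖ : Irreducible ϖ) {x : OF}
    (h : ∀ i, cc Φ x i ∈ lat OK ϖ 1) : IsLocalRing.residue OF x = 0 := by
  have hne := coe_ne_zero hϖ
  have hinv : mono Φ 0 (ϖ : K) * mono Φ 0 (ϖ : K)⁻¹ = 1 := by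
    rw [mono_mul_mono hOK hΦ, mul_inv_cancel₀ hne, add_zero, mono_zero_one hOK hΦ]
  have hy : mono Φ 0 (ϖ : K)⁻¹ * x ∈ OF := by
    rw [mem_iff_cc hΦ]
    intro i
    rw [cc_mono_mul hOK hΦ, sub_zero, ← zpow_neg_one]
    exact h i
  have hx : x = ⟨_, mono_mem hOK hΦ ϖ.2 0⟩ * ⟨_, hy⟩ := by
    refine Subtype.ext ?_
    push_cast
    rw [← mul_assoc, hinv, one_mul]
  rw [hx, map_mul, mul_eq_zero]
  left
  rw [IsLocalRing.residue_eq_zero_iff, IsLocalRing.mem_maximalIdeal]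
  intro hu
  obtain ⟨b, hb⟩ := hu.exists_right_inv
  have h1 : mono Φ 0 (ϖ : K) * b = 1 := congrArg Subtype.val hb
  have h2 : mono Φ 0 (ϖ : K)⁻¹ = b :=
    mul_left_cancel₀ (left_ne_zero_of_mul_eq_one hinv) (hinv.trans h1.symm)
  have h3 := (mem_iff_cc hΦ).1 (h2 ▸ b.2) 0
  rw [cc_mono hOK, Pi.single_eq_same] at h3
  exact hϖ.not_isUnit (IsUnit.of_mul_eq_one ⟨_, h3⟩ (Subtype.ext (mul_inv_cancel₀ hne)))

theorem residue_eq_of_cc {x y : OF} (hxi : ∀ i, cc Φ x i ∈ OK) (hyi : ∀ i, cc Φ y i ∈ OK)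
    (h : ∀ i, IsLocalRing.residue OK ⟨_, hxi i⟩ = IsLocalRing.residue OK ⟨_, hyi i⟩) :
    IsLocalRing.residue OF x = IsLocalRing.residue OF y := by
  obtain ⟨ϖ, hϖ⟩ := exists_irreducible hOK
  rw [← sub_eq_zero, ← map_sub]
  refine residue_eq_zero_of_cc hOK hΦ hϖ fun i => ?_
  have := (residue_eq_iff_sub_mem_lat hOK hϖ).1 (h i)
  rwa [AddSubgroupClass.coe_sub, cc_sub hOK hΦ]

/-- The canonical lifting of `K{{t}}` acts on coefficients by that of `K`. -/
theorem cc_lifting {hK : IsLocalRing.ResidueField OK → OK}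
    (h0 : hK 0 = 0) (hsec : ∀ a, IsLocalRing.residue OK (hK a) = a)
    {h : IsLocalRing.ResidueField OF → OF}
    (hh : ∀ (a : ℤ → IsLocalRing.ResidueField OK) (x : CurlySeries OK) (y : OF),
        (∃ m : ℤ, ∀ i < m, a i = 0) → (∀ i, x.1 i = (hK (a i) : K)) → (y : F) = Φ x →
        h (IsLocalRing.residue OF y) = y) (x : OF) (hx : ∀ i, cc Φ x i ∈ OK) :
    IsLocalRing.residue OF (h (IsLocalRing.residue OF x)) = IsLocalRing.residue OF x ∧
      ∀ i, cc Φ (h (IsLocalRing.residue OF x)) i =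
        hK (IsLocalRing.residue OK ⟨_, hx i⟩) := by
  obtain ⟨ϖ, hϖ⟩ := exists_irreducible hOK
  obtain ⟨m, hm⟩ := ((mem_curlySeries_iff hOK hϖ).1 (cc_mem (Φ := Φ) (x : F))).2 1
  let a : ℤ → IsLocalRing.ResidueField OK := fun i => IsLocalRing.residue OK ⟨_, hx i⟩
  have ha : ∀ i < m, a i = 0 := fun i hi =>
    (residue_eq_zero_iff_mem_lat hOK hϖ).2 (hm i hi.le)
  have hmem : (fun i => (hK (a i) : K)) ∈ CurlySeries OK := by
    refine mem_curlySeries_of_bddBelow hOK hϖ (m := m) (N := 0) (fun i hi => ?_)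
      fun i => mem_lat_zero.2 (hK _).2
    rw [ha i hi, h0]
    rfl
  have hcc : cc Φ (Φ ⟨_, hmem⟩) = fun i => (hK (a i) : K) := cc_apply _
  have hyO : Φ ⟨_, hmem⟩ ∈ OF := by
    rw [mem_iff_cc hΦ, hcc]
    exact fun i => (hK _).2
  have hres : IsLocalRing.residue OF ⟨_, hyO⟩ = IsLocalRing.residue OF x := by
    refine residue_eq_of_cc hOK hΦ (fun i => by rw [hcc]; exact (hK _).2) hx fun i => ?_
    simp only [hcc]
    exact hsec _
  have hy := hh a ⟨_, hmem⟩ ⟨_, hyO⟩ ⟨m, ha⟩ (fun i => rfl) rfl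
  rw [hres] at hy
  rw [hy]
  exact ⟨hres, fun i => congrFun hcc i⟩

/-! ### Power series in `t` -/

/-- The coefficients of a power series, extended by zero. -/
noncomputable def pcoef (f : PowerSeries OK) (i : ℤ) : K :=
  if 0 ≤ i then (PowerSeries.coeff i.toNat f : OK) else 0

omit hOK hΦ in
theorem pcoef_natCast (f : PowerSeries OK) (n : ℕ) :
    pcoef f n = (PowerSeries.coeff n f : OK) := by
  simp [pcoef]

omit hOK hΦ in
theorem pcoef_of_neg (f : PowerSeries OK) {i : ℤ} (hi : i < 0) : pcoef f i = 0 :=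
  if_neg (not_le.2 hi)

omit hOK hΦ in
theorem pcoef_mem (f : PowerSeries OK) (i : ℤ) : pcoef f i ∈ OK := by
  unfold pcoef
  split_ifs
  · exact Subtype.prop _
  · exact OK.zero_mem

omit hΦ in
theorem cc_ofCoef_pcoef (f : PowerSeries OK) : cc Φ (ofCoef Φ (pcoef f)) = pcoef f := by
  obtain ⟨ϖ, hϖ⟩ := exists_irreducible hOK
  exact cc_ofCoef (mem_curlySeries_of_bddBelow hOK hϖ (m := 0) (N := 0)
    (fun i hi => pcoef_of_neg f hi) fun i => mem_lat_zero.2 (pcoef_mem f i))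

theorem ofCoef_pcoef_mem (f : PowerSeries OK) : ofCoef Φ (pcoef f) ∈ OF := by
  rw [mem_iff_cc hΦ, cc_ofCoef_pcoef hOK]
  exact pcoef_mem f

theorem ofCoef_pcoef_mul (f g : PowerSeries OK) :
    ofCoef Φ (pcoef (f * g)) = ofCoef Φ (pcoef f) * ofCoef Φ (pcoef g) := by
  refine cc_injective (Φ := Φ) (funext fun i => ?_)
  rw [cc_ofCoef_pcoef hOK]
  rcases lt_or_ge i 0 with hi | hi
  · rw [pcoef_of_neg _ hi, cc_mul_eq_sum hOK hΦ ∅, Finset.sum_empty]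
    intro j _
    rw [cc_ofCoef_pcoef hOK, cc_ofCoef_pcoef hOK]
    rcases lt_or_ge j 0 with hj | hj
    · rw [pcoef_of_neg _ hj, zero_mul]
    · rw [pcoef_of_neg g (show i - j < 0 by omega), mul_zero]
  · lift i to ℕ using hi
    rw [cc_mul_eq_sum hOK hΦ ((Finset.range (i + 1)).map Nat.castEmbedding), Finset.sum_map,
      pcoef_natCast, PowerSeries.coeff_mul, Finset.Nat.sum_antidiagonal_eq_sum_range_succ_mk]
    · push_cast
      refine Finset.sum_congr rfl fun j hj => ?_
      have hj : j ≤ i := by simpa [Nat.lt_succ_iff] using hj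
      rw [cc_ofCoef_pcoef hOK, cc_ofCoef_pcoef hOK, Nat.castEmbedding_apply, ← Nat.cast_sub hj,
        pcoef_natCast, pcoef_natCast]
    · intro j hj
      rw [cc_ofCoef_pcoef hOK, cc_ofCoef_pcoef hOK]
      rcases lt_or_ge j 0 with hj0 | hj0
      · rw [pcoef_of_neg _ hj0, zero_mul]
      · lift j to ℕ using hj0
        rw [pcoef_of_neg g, mul_zero]
        simp at hj
        omega

omit hΦ in
theorem ofCoef_pcoef_C (c : OK) : ofCoef Φ (pcoef (PowerSeries.C c)) = mono Φ 0 (c : K) := by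
  refine cc_injective (Φ := Φ) (funext fun i => ?_)
  rw [cc_ofCoef_pcoef hOK, cc_mono hOK]
  rcases lt_or_ge i 0 with hi | hi
  · rw [pcoef_of_neg _ hi, Pi.single_eq_of_ne hi.ne]
  · lift i to ℕ using hi
    rw [pcoef_natCast, PowerSeries.coeff_C]
    by_cases h : i = 0
    · simp [h]
    · simp [h]

omit hΦ in
theorem ofCoef_pcoef_X : ofCoef Φ (pcoef (PowerSeries.X : PowerSeries OK)) = mono Φ 1 1 := by
  refine cc_injective (Φ := Φ) (funext fun i => ?_)
  rw [cc_ofCoef_pcoef hOK, cc_mono hOK]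
  rcases lt_or_ge i 0 with hi | hi
  · rw [pcoef_of_neg _ hi, Pi.single_eq_of_ne (by omega)]
  · lift i to ℕ using hi
    rw [pcoef_natCast, PowerSeries.coeff_X]
    by_cases h : i = 1
    · simp [h]
    · rw [Pi.single_eq_of_ne (by exact_mod_cast h)]
      simp [h]

/-- The embedding of power series over the integers of `K` into the integers of `K{{t}}`. -/
noncomputable def powerSeriesHom : PowerSeries OK →+* OF where
  toFun f := ⟨ofCoef Φ (pcoef f), ofCoef_pcoef_mem hOK hΦ f⟩
  map_one' := by
    refine Subtype.ext ?_
    rw [← map_one PowerSeries.C]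
    simp only [ofCoef_pcoef_C hOK]
    exact mono_zero_one hOK hΦ
  map_mul' f g := Subtype.ext (ofCoef_pcoef_mul hOK hΦ f g)
  map_zero' := by
    refine Subtype.ext (cc_injective (Φ := Φ) ?_)
    simp only [cc_ofCoef_pcoef hOK, ZeroMemClass.coe_zero, cc_zero hOK hΦ]
    funext i
    simp [pcoef]
  map_add' f g := by
    refine Subtype.ext (cc_injective (Φ := Φ) ?_)
    simp only [cc_ofCoef_pcoef hOK, AddMemClass.coe_add, cc_add hOK hΦ]
    funext i
    by_cases h : 0 ≤ i <;> simp [pcoef, h]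

theorem coe_powerSeriesHom (f : PowerSeries OK) :
    (powerSeriesHom hOK hΦ f : F) = ofCoef Φ (pcoef f) := rfl

variable {k' : Type u} [Field k'] (θ : IsLocalRing.ResidueField OF ≃+* k')

/-- The reduction of `powerSeriesHom`, followed by an identification of the residue field of
`K{{t}}` with a field `k'`. -/
noncomputable def resHom : PowerSeries OK →+* k' :=
  (θ.toRingHom.comp (IsLocalRing.residue OF)).comp (powerSeriesHom hOK hΦ)

theorem resHom_apply (f : PowerSeries OK) :
    resHom hOK hΦ θ f = θ (IsLocalRing.residue OF (powerSeriesHom hOK hΦ f)) := rfl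

theorem residue_mono_ne_zero (n : ℤ) :
    θ (IsLocalRing.residue OF ⟨_, mono_mem hOK hΦ OK.one_mem n⟩) ≠ 0 := by
  intro h
  have h1 : (⟨_, mono_mem hOK hΦ OK.one_mem n⟩ * ⟨_, mono_mem hOK hΦ OK.one_mem (-n)⟩ : OF) = 1 :=
    Subtype.ext (by
      push_cast
      rw [mono_mul_mono hOK hΦ, mul_one, add_neg_cancel, mono_zero_one hOK hΦ])
  have h2 := congrArg (fun x => θ (IsLocalRing.residue OF x)) h1
  simp only [map_mul, h, zero_mul, map_one] at h2
  exact zero_ne_one h2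

theorem resHom_X : resHom hOK hΦ θ PowerSeries.X =
    θ (IsLocalRing.residue OF ⟨_, mono_mem hOK hΦ OK.one_mem 1⟩) := by
  rw [resHom_apply]
  congr 2
  exact Subtype.ext (ofCoef_pcoef_X hOK)

theorem resHom_X_ne_zero : resHom hOK hΦ θ PowerSeries.X ≠ 0 := by
  rw [resHom_X]
  exact residue_mono_ne_zero hOK hΦ θ 1

theorem residue_mono (n : ℤ) : θ (IsLocalRing.residue OF ⟨_, mono_mem hOK hΦ OK.one_mem n⟩) =
    resHom hOK hΦ θ PowerSeries.X ^ n := by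
  have hadd : ∀ m, θ (IsLocalRing.residue OF ⟨_, mono_mem hOK hΦ OK.one_mem (m + 1)⟩) =
      θ (IsLocalRing.residue OF ⟨_, mono_mem hOK hΦ OK.one_mem m⟩) *
        resHom hOK hΦ θ PowerSeries.X := by
    intro m
    rw [resHom_X, ← map_mul, ← map_mul]
    congr 2
    exact Subtype.ext (by
      push_cast
      rw [mono_mul_mono hOK hΦ, mul_one])
  have hne := resHom_X_ne_zero hOK hΦ θ
  induction n using Int.induction_on with
  | zero =>
    have : (⟨_, mono_mem hOK hΦ OK.one_mem 0⟩ : OF) = 1 :=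
      Subtype.ext (mono_zero_one hOK hΦ)
    rw [this, map_one, map_one, zpow_zero]
  | succ m ih => rw [hadd, ih, zpow_add_one₀ hne]
  | pred m ih =>
    have h1 := hadd (-m - 1)
    have h2 : -(m : ℤ) = -m - 1 + 1 := by ring
    rw [h2, zpow_add_one₀ hne] at ih
    exact mul_right_cancel₀ hne (h1.symm.trans ih)

/-- Modulo the maximal ideal, an integral series is a power of `t` times a power series. -/
theorem residue_eq_zpow_mul_resHom (hϖ : Irreducible ϖ) (x : OF) (hx : ∀ i, cc Φ x i ∈ OK) {n : ℤ}
    (hn : ∀ i < n, cc Φ x i ∈ lat OK ϖ 1) :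
    θ (IsLocalRing.residue OF x) = resHom hOK hΦ θ PowerSeries.X ^ n *
      resHom hOK hΦ θ (PowerSeries.mk fun j => ⟨cc Φ x (n + j), hx _⟩) := by
  set f : PowerSeries OK := PowerSeries.mk fun j => ⟨cc Φ x (n + j), hx _⟩ with hf
  rw [← residue_mono, resHom_apply, ← map_mul, ← map_mul]
  congr 1
  have hcc : ∀ i, cc Φ ((⟨_, mono_mem hOK hΦ OK.one_mem n⟩ * powerSeriesHom hOK hΦ f : OF) : F) i =
      pcoef f (i - n) := by
    intro i
    rw [MulMemClass.coe_mul, cc_mono_mul hOK hΦ, coe_powerSeriesHom, cc_ofCoef_pcoef hOK, one_mul]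
  refine residue_eq_of_cc hOK hΦ hx (fun i => by rw [hcc]; exact pcoef_mem f _) fun i => ?_
  rw [residue_eq_iff_sub_mem_lat hOK hϖ]
  simp only [hcc]
  rcases lt_or_ge i n with hi | hi
  · rw [pcoef_of_neg _ (by omega), sub_zero]
    exact hn i hi
  · obtain ⟨j, rfl⟩ := Int.le.dest hi
    rw [add_sub_cancel_left, pcoef_natCast, hf, PowerSeries.coeff_mk, sub_self]
    exact zero_mem _

theorem exists_eq_zpow_mul_resHom {z : k'} (hz : z ≠ 0) :
    ∃ (n : ℤ) (f : PowerSeries OK), IsUnit f ∧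
      z = resHom hOK hΦ θ PowerSeries.X ^ n * resHom hOK hΦ θ f := by
  obtain ⟨ϖ, hϖ⟩ := exists_irreducible hOK
  obtain ⟨z, rfl⟩ := θ.surjective z
  obtain ⟨x, rfl⟩ := IsLocalRing.residue_surjective z
  have hx := (mem_iff_cc hΦ).1 x.2
  obtain ⟨m, hm⟩ := ((mem_curlySeries_iff hOK hϖ).1 (cc_mem (Φ := Φ) (x : F))).2 1
  obtain ⟨n, hn, hmin⟩ := Int.exists_least_of_bdd (P := fun i => cc Φ x i ∉ lat OK ϖ 1)
    ⟨m, fun i hi => by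
      by_contra! h
      exact hi (hm i h.le)⟩ (by
      by_contra! h
      exact hz (by rw [residue_eq_zero_of_cc hOK hΦ hϖ h, map_zero]))
  refine ⟨n, _, ?_, residue_eq_zpow_mul_resHom hOK hΦ θ hϖ x hx fun i hi => ?_⟩
  · rw [PowerSeries.isUnit_iff_constantCoeff, ← PowerSeries.coeff_zero_eq_constantCoeff_apply,
      PowerSeries.coeff_mk, ← IsLocalRing.notMem_maximalIdeal, ← IsLocalRing.residue_eq_zero_iff,
      residue_eq_zero_iff_mem_lat hOK hϖ]
    simpa using hn
  · by_contra h
    exact absurd (hmin i h) (not_le.2 hi)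

variable {p : ℕ} [hp : Fact p.Prime] [CharP (IsLocalRing.ResidueField OK) p]
  {O' : ValuationSubring k'} (hO' : IsCompleteDVR O')

include hO' p hp

/-- The ring of integers of `k'` contains the power series in `t`, as these form a Henselian
ring. -/
theorem resHom_mem (f : PowerSeries OK) : resHom hOK hΦ θ f ∈ O' := by
  refine map_mem_of_henselianRing (I := Ideal.span {PowerSeries.X}) (p := p) (fun m => ?_) hO'
    (resHom hOK hΦ θ) (Ideal.mem_span_singleton_self _) (resHom_X_ne_zero hOK hΦ θ) f
  rw [PowerSeries.isUnit_iff_constantCoeff, map_natCast, ← IsLocalRing.notMem_maximalIdeal,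
    ← IsLocalRing.residue_eq_zero_iff]
  simp

theorem irreducible_resHom_X :
    Irreducible (⟨_, resHom_mem (p := p) hOK hΦ θ hO' PowerSeries.X⟩ : O') := by
  obtain ⟨π, hπ⟩ := exists_irreducible hO'
  have hne := resHom_X_ne_zero hOK hΦ θ
  have hX : (resHom hOK hΦ θ PowerSeries.X) ∈ lat O' π 1 := by
    rw [← residue_eq_zero_iff_mem_lat hO' hπ
      (x := ⟨_, resHom_mem (p := p) hOK hΦ θ hO' PowerSeries.X⟩), IsLocalRing.residue_eq_zero_iff]
    intro hu
    obtain ⟨v, hv⟩ := hu.exists_right_inv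
    have hv1 : (resHom hOK hΦ θ PowerSeries.X) * v = 1 := congrArg Subtype.val hv
    -- If `t` were a unit, all elements would be integral.
    refine ne_top hO' (eq_top_iff.2 fun z _ => ?_)
    by_cases hz : z = 0
    · exact hz ▸ O'.zero_mem
    obtain ⟨n, f, -, rfl⟩ := exists_eq_zpow_mul_resHom hOK hΦ θ hz
    refine O'.mul_mem _ _ ?_ (resHom_mem (p := p) hOK hΦ θ hO' f)
    obtain ⟨n, rfl | rfl⟩ := n.eq_nat_or_neg
    · rw [zpow_natCast]
      exact O'.toSubring.pow_mem (resHom_mem (p := p) hOK hΦ θ hO' PowerSeries.X) n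
    · rw [zpow_neg, ← inv_zpow, ← eq_inv_of_mul_eq_one_right hv1, zpow_natCast]
      exact O'.toSubring.pow_mem v.2 n
  obtain ⟨u, e, he⟩ := exists_unit_mul_zpow hO' hπ hne
  obtain ⟨n, f, hf, hn⟩ := exists_eq_zpow_mul_resHom hOK hΦ θ (coe_ne_zero hπ)
  have he1 : 1 ≤ e := by rwa [he, unit_mul_zpow_mem_lat hπ] at hX
  have hw : IsUnit (⟨_, resHom_mem (p := p) hOK hΦ θ hO' f⟩ : O') := by
    obtain ⟨g, hg⟩ := hf.exists_right_inv
    refine IsUnit.of_mul_eq_one ⟨_, resHom_mem (p := p) hOK hΦ θ hO' g⟩ (Subtype.ext ?_)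
    push_cast
    rw [← map_mul, hg, map_one]
  obtain ⟨w, hw⟩ := hw
  have hw' : resHom hOK hΦ θ f = (w : O') := (congrArg Subtype.val hw).symm
  have hπ' : (π : k') = ((u ^ n * w : O'ˣ) : O') * (π : k') ^ (e * n) := by
    conv_lhs => rw [hn, he, hw', mul_zpow, ← zpow_mul]
    rw [Units.val_mul, MulMemClass.coe_mul, coe_unit_zpow]
    ring
  have hen : e * n = 1 := by
    have h1 : (π : k') ∈ lat O' π (e * n) := by
      have := (unit_mul_zpow_mem_lat hπ (u ^ n * w) (m := e * n)).2 le_rfl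
      rwa [← hπ'] at this
    have h2 : (π : k') ∈ lat O' π 1 := by simpa using zpow_mem_lat hπ 1
    refine le_antisymm ?_ ?_
    · have h3 : ((1 : O'ˣ) : O') * (π : k') ^ (1 : ℤ) ∈ lat O' π (e * n) := by simpa using h1
      exact (unit_mul_zpow_mem_lat hπ _).1 h3
    · rw [hπ'] at h2
      exact (unit_mul_zpow_mem_lat hπ _).1 h2
  have he2 : e = 1 := by
    rcases Int.eq_one_or_neg_one_of_mul_eq_one hen with h | h <;> omega
  have hassoc : Associated π (⟨_, resHom_mem (p := p) hOK hΦ θ hO' PowerSeries.X⟩ : O') :=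
    ⟨u, Subtype.ext (by
      push_cast
      rw [he, he2, zpow_one, mul_comm])⟩
  exact hassoc.irreducible hπ

/-- The residue field of `K{{t}}` is the field of Laurent series in `t` over the residue field of
`K`: coefficientwise reduction gives the expansion with respect to a coefficient field that is
isomorphic to the residue field of `K`, and to the uniformizer `t`. -/
theorem exists_coefficientField :
    ∃ (θl : IsLocalRing.ResidueField OK ≃+* IsLocalRing.ResidueField O')
      (s : IsLocalRing.ResidueField O' →+* O') (τ : O'), Irreducible τ ∧
      (∀ a, IsLocalRing.residue O' (s a) = a) ∧
      ∀ (x : OF) (hx : ∀ i, cc Φ x i ∈ OK) (i : ℤ),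
        coef O' s τ (θ (IsLocalRing.residue OF x)) i = θl (IsLocalRing.residue OK ⟨_, hx i⟩) := by
  obtain ⟨ϖ, hϖ⟩ := exists_irreducible hOK
  have hmem := resHom_mem (p := p) hOK hΦ θ hO'
  have hτ := irreducible_resHom_X (p := p) hOK hΦ θ hO'
  set τ : O' := ⟨_, hmem PowerSeries.X⟩ with hτdef
  let φ : PowerSeries OK →+* O' := (resHom hOK hΦ θ).codRestrict O'.toSubring hmem
  have hφ : ∀ f, (φ f : k') = resHom hOK hΦ θ f := fun f => rfl
  have hC : ∀ c : OK, IsLocalRing.residue OK c = 0 → φ (PowerSeries.C c) = 0 := by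
    intro c hc
    refine Subtype.ext ?_
    rw [hφ, resHom_apply, residue_eq_zero_of_cc hOK hΦ hϖ, map_zero]
    · rfl
    · intro i
      rw [coe_powerSeriesHom, ofCoef_pcoef_C hOK, cc_mono hOK]
      by_cases h : i = 0
      · subst h
        rw [Pi.single_eq_same]
        exact (residue_eq_zero_iff_mem_lat hOK hϖ).1 hc
      · rw [Pi.single_eq_of_ne h]
        exact zero_mem _
  let j : IsLocalRing.ResidueField OK →+* O' :=
    Ideal.Quotient.lift _ (φ.comp PowerSeries.C) fun c hc =>
      hC c ((IsLocalRing.residue_eq_zero_iff c).2 hc)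
  have hj : ∀ c, j (IsLocalRing.residue OK c) = φ (PowerSeries.C c) := fun c => rfl
  have hsurj : Function.Surjective ((IsLocalRing.residue O').comp j) := by
    intro l
    obtain ⟨z, rfl⟩ := IsLocalRing.residue_surjective l
    by_cases hz : (z : k') = 0
    · refine ⟨0, ?_⟩
      have : z = 0 := Subtype.ext hz
      rw [this, map_zero, map_zero]
    obtain ⟨n, f, hf, hn⟩ := exists_eq_zpow_mul_resHom hOK hΦ θ hz
    obtain ⟨g, hg⟩ := hf.exists_right_inv
    have hn0 : 0 ≤ n := by
      have h1 : (z : k') * resHom hOK hΦ θ g = ((1 : O'ˣ) : O') * (τ : k') ^ n := by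
        rw [hn, mul_assoc, ← map_mul, hg, map_one]
        simp [hτdef]
      rw [← unit_mul_zpow_mem_lat hτ (1 : O'ˣ), ← h1, mem_lat_zero]
      exact O'.mul_mem _ _ z.2 (hmem g)
    lift n to ℕ using hn0
    have hz' : z = φ (PowerSeries.X ^ n * f) := by
      refine Subtype.ext ?_
      rw [hφ, map_mul, map_pow, hn, zpow_natCast]
    refine ⟨IsLocalRing.residue OK (PowerSeries.constantCoeff (PowerSeries.X ^ n * f)), ?_⟩
    rw [RingHom.comp_apply, hj, hz']
    generalize PowerSeries.X ^ n * f = q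
    conv_rhs => rw [PowerSeries.eq_X_mul_shift_add_const q]
    have hφX : IsLocalRing.residue O' (φ PowerSeries.X) = 0 := by
      rw [IsLocalRing.residue_eq_zero_iff]
      exact hτ.not_isUnit
    rw [map_add, map_mul, map_add, map_mul, hφX, zero_mul, zero_add]
  let θl := RingEquiv.ofBijective ((IsLocalRing.residue O').comp j)
    ⟨((IsLocalRing.residue O').comp j).injective, hsurj⟩
  let s := j.comp θl.symm.toRingHom
  have hs : ∀ a, IsLocalRing.residue O' (s a) = a := fun a => θl.apply_symm_apply a
  refine ⟨θl, s, τ, hτ, hs, fun x hx i => ?_⟩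
  have hsj : ∀ c, (s (θl c) : k') = j c := fun c => by
    show ((j (θl.symm (θl c)) : O') : k') = j c
    rw [θl.symm_apply_apply]
  obtain ⟨m, hm⟩ := ((mem_curlySeries_iff hOK hϖ).1 (cc_mem (Φ := Φ) (x : F))).2 1
  -- The truncations of the expansion leave a remainder divisible by the right power of `t`.
  let R : ℤ → PowerSeries OK := fun n => PowerSeries.mk fun j => ⟨cc Φ x (n + j), hx _⟩
  have htrunc : ∀ n, m ≤ n → θ (IsLocalRing.residue OF x) - ∑ i ∈ Finset.Ico m n,
      (s (θl (IsLocalRing.residue OK ⟨_, hx i⟩)) : k') * (τ : k') ^ i =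
        (τ : k') ^ n * resHom hOK hΦ θ (R n) := by
    intro n hn
    induction n, hn using Int.leInduction with
    | base =>
      rw [Finset.Ico_self, Finset.sum_empty, sub_zero]
      exact residue_eq_zpow_mul_resHom hOK hΦ θ hϖ x hx fun i hi => hm i hi.le
    | succ n hn ih =>
      have hR : R n = PowerSeries.X * R (n + 1) + PowerSeries.C ⟨_, hx n⟩ := by
        conv_lhs => rw [PowerSeries.eq_X_mul_shift_add_const (R n)]
        congr 2
        · ext l
          simp only [R, PowerSeries.coeff_mk]
          push_cast
          rw [add_right_comm, ← add_assoc]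
        · simp [R, ← PowerSeries.coeff_zero_eq_constantCoeff_apply]
      rw [sum_Ico_succ_of_le _ hn, ← sub_sub, ih, hR, map_add, map_mul, hsj, hj, hφ,
        zpow_add_one₀ (coe_ne_zero hτ), hτdef]
      ring
  refine congrFun (IsSeriesSum.coef_eq (f := fun i => θl (IsLocalRing.residue OK ⟨_, hx i⟩))
    hO' hτ hs ?_) i
  refine isSeriesSum_of_sub_sum_mem_lat hO' hτ (map_zero s) (m := m) (fun i hi => ?_) fun n hn => ?_
  · rw [(residue_eq_zero_iff_mem_lat hOK hϖ).2 (hm i hi.le), map_zero]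
  · rw [htrunc n hn]
    exact zpow_mul_mem_lat hτ (hmem _)

end CurlyResidue

/-! ### The canonical lifting of a standard field -/

theorem IsCanonicalLifting.section_spec {F : Type u} [Field F] {O : ValuationSubring F}
    {h : IsLocalRing.ResidueField O → O} (hh : IsCanonicalLifting O h) :
    h 0 = 0 ∧ ∀ a, IsLocalRing.residue O (h a) = a := by
  induction hh with
  | @base K _ _ OK hOK hfin h hsec =>
    refine ⟨?_, hsec⟩
    -- `h 0` is an idempotent of the maximal ideal.
    have h1 : h 0 * h 0 = h 0 := by rw [← map_mul, mul_zero]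
    by_contra h0
    have h2 : h 0 = 1 := mul_left_cancel₀ h0 (by rw [h1, mul_one])
    have h3 := hsec 0
    rw [h2, map_one] at h3
    exact one_ne_zero h3
  | @step K F _ _ OK OF hK hhK hOF Φ hΦ h hh ih =>
    have hOK := hhK.isCompleteDVR
    have hcc := cc_lifting hOK hΦ ih.1 ih.2 hh
    refine ⟨Subtype.ext (cc_injective (Φ := Φ) (funext fun i => ?_)), fun a => ?_⟩
    · have := (hcc 0 fun i => by simp [cc_zero hOK hΦ, OK.zero_mem]).2 i
      rw [map_zero] at this
      rw [this]
      simp only [ZeroMemClass.coe_zero, cc_zero hOK hΦ, Pi.zero_apply]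
      have h0 : IsLocalRing.residue OK 0 = 0 := map_zero _
      exact (congrArg (fun a => (hK a : K)) h0).trans (congrArg Subtype.val ih.1)
    · obtain ⟨x, rfl⟩ := IsLocalRing.residue_surjective a
      exact (hcc x ((mem_iff_cc hΦ).1 x.2)).1

/-! ### Subgroups that are neighbourhoods of zero along the canonical lifting -/

section Good

variable {F : Type u} [Field F] {O : ValuationSubring F} {h : IsLocalRing.ResidueField O → O}
  {k' : Type u} [Field k'] {θ : IsLocalRing.ResidueField O ≃+* k'} {σ : TopologicalSpace k'}

/-- An additive subgroup `G` of `F` is good if for each `c` in `F` the element `h a * c` lies in `G`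
for all sufficiently small `a` in the residue field of `F`, which is identified with the
topological field `k'` through `θ`. -/
def IsGood (h : IsLocalRing.ResidueField O → O) (θ : IsLocalRing.ResidueField O ≃+* k')
    (σ : TopologicalSpace k') (G : AddSubgroup F) : Prop :=
  ∀ c : F, ∃ H : AddSubgroup k', IsOpen[σ] (H : Set k') ∧ ∀ a, θ a ∈ H → (h a : F) * c ∈ G

theorem IsGood.mono {G G' : AddSubgroup F} (hG : IsGood h θ σ G) (hle : G ≤ G') :
    IsGood h θ σ G' := fun c => by
  obtain ⟨H, hH, hc⟩ := hG c
  exact ⟨H, hH, fun a ha => hle (hc a ha)⟩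

theorem isGood_top : IsGood h θ σ ⊤ := fun _ => ⟨⊤, @isOpen_univ _ σ, fun _ _ => trivial⟩

theorem IsGood.inf {G G' : AddSubgroup F} (hG : IsGood h θ σ G) (hG' : IsGood h θ σ G') :
    IsGood h θ σ (G ⊓ G') := fun c => by
  obtain ⟨H, hH, hc⟩ := hG c
  obtain ⟨H', hH', hc'⟩ := hG' c
  exact ⟨H ⊓ H', @IsOpen.inter _ σ _ _ hH hH', fun a ha => ⟨hc a ha.1, hc' a ha.2⟩⟩

theorem IsGood.comap_mulLeft {G : AddSubgroup F} (hG : IsGood h θ σ G) (d : F) :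
    IsGood h θ σ (G.comap (AddMonoidHom.mulLeft d)) := fun c => by
  obtain ⟨H, hH, hc⟩ := hG (d * c)
  refine ⟨H, hH, fun a ha => ?_⟩
  have := hc a ha
  rwa [mul_left_comm] at this

/-- The lifting `h` has the reduction property if each open subgroup of the residue field contains
the reductions of the integral elements of some good subgroup. -/
def HasGoodReduction (h : IsLocalRing.ResidueField O → O)
    (θ : IsLocalRing.ResidueField O ≃+* k') (σ : TopologicalSpace k') : Prop :=
  ∀ U : AddSubgroup k', IsOpen[σ] (U : Set k') → ∃ G : AddSubgroup F, IsGood h θ σ G ∧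
    ∀ x : O, (x : F) ∈ G → θ (IsLocalRing.residue O x) ∈ U

/-- The maximal ideal may be added to a good subgroup. -/
theorem HasGoodReduction.exists_lat_le (hgood : HasGoodReduction h θ σ) (hO : IsCompleteDVR O)
    {π : O} (hπ : Irreducible π) {U : AddSubgroup k'} (hU : IsOpen[σ] (U : Set k')) :
    ∃ G : AddSubgroup F, IsGood h θ σ G ∧ lat O π 1 ≤ G ∧
      ∀ x : O, (x : F) ∈ G → θ (IsLocalRing.residue O x) ∈ U := by
  obtain ⟨G, hG, hGU⟩ := hgood U hU
  refine ⟨G ⊔ lat O π 1, hG.mono le_sup_left, le_sup_right, fun x hx => ?_⟩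
  obtain ⟨g, hg, m, hm, hgm⟩ := AddSubgroup.mem_sup.1 hx
  have hmO := mem_of_mem_lat hπ zero_le_one hm
  have hgO : g ∈ O := by
    rw [← eq_sub_iff_add_eq] at hgm
    exact hgm ▸ O.sub_mem x.2 hmO
  have hx' : x = ⟨g, hgO⟩ + ⟨m, hmO⟩ := Subtype.ext hgm.symm
  rw [hx', map_add, (residue_eq_zero_iff_mem_lat hO hπ (x := ⟨m, hmO⟩)).2 hm, add_zero]
  exact hGU ⟨g, hgO⟩ hg

theorem hasGoodReduction_bot (h0 : h 0 = 0) :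
    HasGoodReduction h θ (⊥ : TopologicalSpace k') := by
  intro U _
  refine ⟨⊥, fun c => ⟨⊥, trivial, fun a ha => ?_⟩, fun x hx => ?_⟩
  · have : a = 0 := by simpa using ha
    rw [this, h0]
    simp
  · have : x = 0 := Subtype.ext (by simpa using hx)
    rw [this, map_zero, map_zero]
    exact zero_mem _

/-- Passage from `K` to `K{{t}}`. The condition on a product imposed at a coefficient `j` only
involves finitely many coefficients of the factors modulo the maximal ideal. -/
theorem hasGoodReduction_step {K F : Type u} [Field K] [Field F] {OK : ValuationSubring K}
    {OF : ValuationSubring F} {hK : IsLocalRing.ResidueField OK → OK}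
    (hOK : IsCompleteDVR OK) (h0 : hK 0 = 0)
    (hsec : ∀ a, IsLocalRing.residue OK (hK a) = a)
    {Φ : CurlySeries OK ≃ F} (hΦ : IsCurlyIso OK OF Φ)
    {h : IsLocalRing.ResidueField OF → OF}
    (hh : ∀ (a : ℤ → IsLocalRing.ResidueField OK) (x : CurlySeries OK) (y : OF),
        (∃ m : ℤ, ∀ i < m, a i = 0) → (∀ i, x.1 i = (hK (a i) : K)) → (y : F) = Φ x →
        h (IsLocalRing.residue OF y) = y)
    {k' : Type u} [Field k'] (θ : IsLocalRing.ResidueField OF ≃+* k') {O' : ValuationSubring k'}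
    (hO' : IsCompleteDVR O') {σl : TopologicalSpace (IsLocalRing.ResidueField O')}
    (hσl : IsLinearTop σl) (θl : IsLocalRing.ResidueField OK ≃+* IsLocalRing.ResidueField O')
    {s : IsLocalRing.ResidueField O' →+* O'} {τ : O'} (hτ : Irreducible τ)
    (hs : ∀ a, IsLocalRing.residue O' (s a) = a)
    (hcoef : ∀ (x : OF) (hx : ∀ i, cc Φ x i ∈ OK) (i : ℤ),
        coef O' s τ (θ (IsLocalRing.residue OF x)) i = θl (IsLocalRing.residue OK ⟨_, hx i⟩))
    (hgood : HasGoodReduction hK θl σl) :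
    HasGoodReduction h θ (seriesTopology O' σl s τ) := by
  obtain ⟨ϖ, hϖ⟩ := exists_irreducible hOK
  intro U hU
  obtain ⟨V, hV, hVU⟩ := hU 0 (zero_mem _)
  obtain ⟨H, j₀, hH, hj₀, hHV⟩ := exists_basicSubgroup hσl hO' hτ hs hV
  have hHU : ∀ z, (∀ i, coef O' s τ z i ∈ H i) → z ∈ U := fun z hz => by
    simpa using hVU z (hHV hz)
  choose G' hG' hG'lat hG'H using fun j => hgood.exists_lat_le hOK hϖ (hH j)
  let G : ℤ → AddSubgroup K := fun j => if j₀ ≤ j then ⊤ else G' j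
  have hG : ∀ j, IsGood hK θl σl (G j) := fun j => by
    by_cases hj : j₀ ≤ j
    · simp only [G, hj, if_true]
      exact isGood_top
    · simp only [G, hj, if_false]
      exact hG' j
  have hGlat : ∀ j, lat OK ϖ 1 ≤ G j := fun j => by
    by_cases hj : j₀ ≤ j
    · simp [G, hj]
    · simp only [G, hj, if_false]
      exact hG'lat j
  refine ⟨⨅ j, (G j).comap (ccHom hOK hΦ j), fun c => ?_, fun x hx => hHU _ fun j => ?_⟩
  · obtain ⟨J, hJ⟩ := ((mem_curlySeries_iff hOK hϖ).1 (cc_mem (Φ := Φ) c)).2 1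
    choose A hA hAG using fun i j => hG j (cc Φ c (j - i))
    let W : ℤ → AddSubgroup (IsLocalRing.ResidueField O') := fun i =>
      if j₀ - J ≤ i then ⊤ else ⨅ j ∈ Finset.Ioo (i + J) j₀, A i j
    have hW : ∀ i, IsOpen[σl] (W i : Set (IsLocalRing.ResidueField O')) := by
      intro i
      by_cases hi : j₀ - J ≤ i
      · simp only [W, hi, if_true]
        exact @isOpen_univ _ σl
      · simp only [W, hi, if_false, AddSubgroup.coe_iInf]
        exact @isOpen_biInter_finset _ _ σl _ _ fun j _ => hA i j
    refine ⟨basicSubgroup hO' hτ hs W,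
      isOpen_basicSubgroup hO' hτ hs hW (i₀ := j₀ - J) fun i hi => if_pos hi, fun a ha => ?_⟩
    obtain ⟨x, rfl⟩ := IsLocalRing.residue_surjective a
    have hx := (mem_iff_cc hΦ).1 x.2
    obtain ⟨-, hcc⟩ := cc_lifting hOK hΦ h0 hsec hh x hx
    rw [AddSubgroup.mem_iInf]
    intro j
    show cc Φ _ j ∈ G j
    by_cases hj : j₀ ≤ j
    · simp [G, hj]
    refine cc_mul_mem hOK hΦ hϖ (hGlat j) fun i => ?_
    rw [hcc]
    by_cases hij : j - i ≤ J
    · exact hGlat j (mul_mem_lat_of_mem hϖ (Subtype.prop _) (hJ _ hij))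
    · refine hAG i j _ ?_
      have hi := ha i
      rw [hcoef x hx i] at hi
      simp only [W, show ¬ j₀ - J ≤ i by omega, if_false, AddSubgroup.mem_iInf] at hi
      exact hi j (Finset.mem_Ioo.2 ⟨by omega, by omega⟩)
  · rw [hcoef x ((mem_iff_cc hΦ).1 x.2)]
    by_cases hj : j₀ ≤ j
    · simp [hj₀ j hj]
    · have hxj : cc Φ x j ∈ G j := AddSubgroup.mem_iInf.1 hx j
      simp only [G, hj, if_false] at hxj
      exact hG'H j _ hxj

end Good

theorem higherTopology_unique {p : ℕ} [hp : Fact p.Prime] {n : ℕ} {k : Type u} [Field k]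
    [CharP k p] {σ σ' : TopologicalSpace k} (hσ : IsHigherTopology n k σ)
    (hσ' : IsHigherTopology n k σ') : σ = σ' := by
  have key : ∀ {σ σ' : TopologicalSpace k}, IsHigherTopology n k σ → IsHigherTopology n k σ' →
      σ ≤ σ' := fun {σ σ'} h h' => (@continuous_id_iff_le _ σ σ').1
    (continuous_of_semilinear (p := p) n (k := k) (A := k) (B := k) h h h' (RingHom.Finite.id k)
      (RingHom.Finite.id k) (AddMonoidHom.id k) fun c a => rfl)
  exact le_antisymm (key hσ hσ') (key hσ' hσ)

/-- Canonical liftings have the reduction property, for all higher topologies of the residue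
field. -/
theorem IsCanonicalLifting.hasGoodReduction {F : Type u} [Field F] {O : ValuationSubring F}
    {h : IsLocalRing.ResidueField O → O} (hh : IsCanonicalLifting O h) :
    ∃ p : ℕ, p.Prime ∧ CharP (IsLocalRing.ResidueField O) p ∧
      ∀ (n : ℕ) {k' : Type u} [Field k'] (θ : IsLocalRing.ResidueField O ≃+* k')
        (σ : TopologicalSpace k'), IsHigherTopology n k' σ → HasGoodReduction h θ σ := by
  induction hh with
  | @base K _ _ OK hOK hfin h hsec =>
    have h0 := (IsCanonicalLifting.base OK hOK hfin h hsec).section_spec.1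
    obtain ⟨p, hp⟩ := CharP.exists (IsLocalRing.ResidueField OK)
    refine ⟨p, (CharP.char_is_prime_or_zero (IsLocalRing.ResidueField OK) p).resolve_right
      fun hp0 => ?_, hp, ?_⟩
    · subst hp0
      have := CharP.charP_to_charZero (IsLocalRing.ResidueField OK)
      exact not_finite (IsLocalRing.ResidueField OK)
    · rintro (_ | n) k' _ θ σ hσ
      · obtain ⟨-, rfl⟩ := hσ
        exact hasGoodReduction_bot h0
      · -- A finite field carries no discrete valuation.
        obtain ⟨O', -, hO', -⟩ := hσ
        obtain ⟨π, hπ⟩ := exists_irreducible hO'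
        have : Finite k' := Finite.of_equiv _ θ.toEquiv
        have hinj : Function.Injective fun n : ℕ => (π : k') ^ (n : ℤ) := by
          intro m n hmn
          have h1 : ∀ m n : ℕ, (π : k') ^ (m : ℤ) = (π : k') ^ (n : ℤ) → m ≤ n := by
            intro m n hmn
            have := zpow_mem_lat hπ (m : ℤ)
            rw [hmn] at this
            have h2 : ((1 : O'ˣ) : O') * (π : k') ^ (n : ℤ) ∈ lat O' π m := by simpa using this
            exact_mod_cast (unit_mul_zpow_mem_lat hπ _).1 h2
          exact le_antisymm (h1 _ _ hmn) (h1 _ _ hmn.symm)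
        exact absurd (Finite.of_injective _ hinj) (not_finite_iff_infinite.2 inferInstance)
  | step OK OF hK hhK hOF Φ hΦ h hh ih =>
    obtain ⟨p, hp, hchar, ih⟩ := ih
    have hOK := hhK.isCompleteDVR
    have hfact : Fact p.Prime := ⟨hp⟩
    have h0 := (IsCanonicalLifting.step OK OF hK hhK hOF Φ hΦ h hh).section_spec.1
    have hcharF : CharP (IsLocalRing.ResidueField OF) p := by
      refine (CharP.charP_iff_prime_eq_zero (R := IsLocalRing.ResidueField OF) hp).2 ?_
      obtain ⟨ϖ, hϖ⟩ := exists_irreducible hOK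
      rw [← map_natCast (IsLocalRing.residue OF)]
      refine residue_eq_zero_of_cc hOK hΦ hϖ fun i => ?_
      have h1 : IsLocalRing.residue OK p = 0 := by simp
      have h2 := (residue_eq_zero_iff_mem_lat hOK hϖ).1 h1
      have h3 := cc_natCast_mul hOK hΦ p 1 i
      rw [mul_one] at h3
      push_cast at h2 ⊢
      rw [h3, mul_comm]
      exact mul_mem_lat_of_mem hϖ ((mem_iff_cc hΦ).1 OF.one_mem i) h2
    refine ⟨p, hp, hcharF, ?_⟩
    rintro (_ | n) k' _ θ σ hσ
    · obtain ⟨-, rfl⟩ := hσ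
      exact hasGoodReduction_bot h0
    · have : CharP k' p := charP_of_injective_ringHom (f := θ.toRingHom) θ.injective p
      obtain ⟨O', σl, s', π', hO', hσl, hs', hπ', rfl⟩ := hσ.exists_of_charP hp.ne_zero
      have := charP_residueField (p := p) O'
      obtain ⟨θl, s, τ, hτ, hs, hcoef⟩ := exists_coefficientField (p := p) hOK hΦ θ hO'
      have hσ' : IsHigherTopology (n + 1) k' (seriesTopology O' σl s τ) :=
        ⟨O', σl, hO', hσl, .equalChar s hs τ hτ⟩
      rw [higherTopology_unique (p := p) hσ hσ']
      exact hasGoodReduction_step hOK hhK.section_spec.1 hhK.section_spec.2 hΦ hh θ hO'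
        (IsHigherTopology.isLinearTop (p := p) n hσl) θl hτ hs hcoef (ih n θl σl hσl)

/-! ### Basic sets of a standard field contain good subgroups -/

section BasicSet

variable {F : Type u} [Field F] {O : ValuationSubring F} {h : IsLocalRing.ResidueField O → O}
  {σ : TopologicalSpace (IsLocalRing.ResidueField O)} {π : O}

/-- The refinement of a good subgroup `G` used at the `i`-th step of an expansion: the digit of an
element of the refinement divisible by `π ^ i` is small, and its lifting times `π ^ i`
belongs to `G`. -/
theorem exists_good_refinement (hgood : HasGoodReduction h (RingEquiv.refl _) σ)
    {G : AddSubgroup F} (hG : IsGood h (RingEquiv.refl _) σ G)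
    {U : AddSubgroup (IsLocalRing.ResidueField O)}
    (hU : IsOpen[σ] (U : Set (IsLocalRing.ResidueField O))) (i : ℤ) :
    ∃ G' ≤ G, IsGood h (RingEquiv.refl _) σ G' ∧ ∀ (y : F) (hy : y ∈ lat O π i), y ∈ G' →
      IsLocalRing.residue O ⟨_, hy⟩ ∈ U ∧
        (h (IsLocalRing.residue O ⟨_, hy⟩) : F) * (π : F) ^ i ∈ G := by
  obtain ⟨H, hH, hHG⟩ := hG ((π : F) ^ i)
  obtain ⟨G₁, hG₁, hG₁U⟩ := hgood (U ⊓ H) (@IsOpen.inter _ σ _ _ hU hH)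
  refine ⟨G ⊓ G₁.comap (AddMonoidHom.mulLeft ((π : F) ^ (-i))), inf_le_left,
    hG.inf (hG₁.comap_mulLeft _), fun y hy hyG => ?_⟩
  have := hG₁U ⟨_, hy⟩ hyG.2
  exact ⟨this.1, hHG _ this.2⟩

theorem exists_good_le_basicSet (hO : IsCompleteDVR O) (hπ : Irreducible π) (h0 : h 0 = 0)
    (hs : ∀ a, IsLocalRing.residue O (h a) = a) (hσ : IsLinearTop σ)
    (hgood : HasGoodReduction h (RingEquiv.refl _) σ)
    {U : ℤ → Set (IsLocalRing.ResidueField O)} (hU : IsAdmissible σ U) :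
    ∃ G : AddSubgroup F, IsGood h (RingEquiv.refl _) σ G ∧ (G : Set F) ⊆ basicSet O h π U := by
  obtain ⟨i₀, hi₀⟩ := hU.eventually_univ
  choose H hH hHU using fun i => hσ.exists_subgroup (hU.isOpen i) (hU.zero_mem i)
  -- The subgroups attached to the digits are chosen downwards, starting from the index `i₀`, beyond
  -- which there is no condition.
  choose! R hRle hRgood hR using fun (G : AddSubgroup F)
    (hG : IsGood h (RingEquiv.refl _) σ G) (i : ℤ) =>
      exists_good_refinement (π := π) hgood hG (hH i) i
  let Γ : ℕ → AddSubgroup F := fun k =>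
    Nat.rec ⊤ (fun k G => R G (i₀ - (k + 1 : ℕ))) k
  have hΓ : ∀ k, IsGood h (RingEquiv.refl _) σ (Γ k) := by
    intro k
    induction k with
    | zero => exact isGood_top
    | succ k ih => exact hRgood _ ih _
  let G : ℤ → AddSubgroup F := fun i => Γ (i₀ - i).toNat
  have hG : ∀ i, IsGood h (RingEquiv.refl _) σ (G i) := fun i => hΓ _
  have hGstep : ∀ i, G i ≤ G (i + 1) ∧ ∀ (y : F) (hy : y ∈ lat O π i), y ∈ G i →
      IsLocalRing.residue O ⟨_, hy⟩ ∈ U i ∧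
        (h (IsLocalRing.residue O ⟨_, hy⟩) : F) * (π : F) ^ i ∈ G (i + 1) := by
    intro i
    by_cases hi : i₀ ≤ i
    · have h1 : G (i + 1) = ⊤ := by
        simp only [G, show (i₀ - (i + 1)).toNat = 0 by omega]
        rfl
      rw [h1]
      exact ⟨le_top, fun y hy _ => ⟨by rw [hi₀ i hi]; trivial, trivial⟩⟩
    · obtain ⟨k, hk⟩ : ∃ k : ℕ, i = i₀ - (k + 1 : ℕ) := ⟨(i₀ - i - 1).toNat, by omega⟩
      have h1 : G i = R (Γ k) i := by
        simp only [G, show (i₀ - i).toNat = k + 1 by omega]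
        rw [hk]
      have h2 : G (i + 1) = Γ k := by
        simp only [G, show (i₀ - (i + 1)).toNat = k by omega]
      rw [h1, h2]
      refine ⟨hRle _ (hΓ k) i, fun y hy hyG => ?_⟩
      have := hR _ (hΓ k) i y hy hyG
      exact ⟨hHU i this.1, this.2⟩
  let S : ℤ → AddSubgroup F := fun i => ⨆ c ≥ i, G c ⊓ lat O π c
  have hSle : ∀ i c, i ≤ c → G c ⊓ lat O π c ≤ S i := fun i c hc =>
    le_iSup₂_of_le (f := fun c (_ : c ≥ i) => G c ⊓ lat O π c) c hc le_rfl
  have hSlat : ∀ i, S i ≤ lat O π i := fun i =>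
    iSup₂_le fun c hc => inf_le_right.trans (lat_anti hπ hc)
  have hSsucc : ∀ i, S i ≤ (G i ⊓ lat O π i) ⊔ S (i + 1) := fun i =>
    iSup₂_le fun c hc => by
      rcases eq_or_lt_of_le (show i ≤ c from hc) with rfl | hlt
      · exact le_sup_left
      · exact (hSle (i + 1) c (by omega)).trans le_sup_right
  have hdir : Directed (· ≤ ·) S := by
    refine Antitone.directed_le fun i j hij => iSup₂_le fun c hc => hSle i c (hij.trans hc)
  refine ⟨⨆ i, S i, fun c => ?_, fun x hx => ?_⟩
  · obtain ⟨N, hN⟩ := exists_mem_lat hO hπ c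
    obtain ⟨A, hA, hAG⟩ := hG N c
    refine ⟨A, hA, fun a ha => ?_⟩
    exact le_iSup S N (hSle N N le_rfl ⟨hAG a ha, mul_mem_lat_of_mem hπ (h a).2 hN⟩)
  · obtain ⟨m, hm⟩ := (AddSubgroup.mem_iSup_of_directed hdir).1 hx
    refine exists_isSeriesSum_of_step hO hπ h0 U hU.zero_mem (fun i y => y ∈ S i)
      (fun i y hy => ?_) (fun i y hy => hSlat i hy) hm
    obtain ⟨g, hg, r, hr, rfl⟩ := AddSubgroup.mem_sup.1 (hSsucc i hy)
    obtain ⟨hdig, hdigG⟩ := (hGstep i).2 g hg.2 hg.1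
    refine ⟨_, hdig, ?_⟩
    rw [add_sub_right_comm]
    refine add_mem (hSle _ _ le_rfl ⟨?_, sub_digit_mem_lat hO hπ hs hg.2⟩) hr
    exact (G (i + 1)).sub_mem ((hGstep i).1 hg.1) hdigG

end BasicSet

/-! ### Translation invariance -/

theorem continuous_add_left_seriesTopology {F : Type u} [Field F] (O : ValuationSubring F)
    (σ : TopologicalSpace (IsLocalRing.ResidueField O)) (h : IsLocalRing.ResidueField O → O)
    (π : O) (c : F) : @Continuous F F (seriesTopology O σ h π) (seriesTopology O σ h π)
      fun x => c + x := by
  refine @Continuous.mk _ _ (seriesTopology O σ h π) (seriesTopology O σ h π) _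
    fun V hV x hx => ?_
  obtain ⟨U, hU, hUV⟩ := hV _ hx
  exact ⟨U, hU, fun y hy => by simpa [add_assoc] using hUV y hy⟩

theorem IsConstructedFrom.continuous_add_left {P : ∀ (k : Type u) [Field k],
      TopologicalSpace k → Prop} {F : Type u} [Field F] {O : ValuationSubring F}
    {σ : TopologicalSpace (IsLocalRing.ResidueField O)} {τ : TopologicalSpace F}
    (hτ : IsConstructedFrom P O σ τ) (c : F) : @Continuous F F τ τ fun x => c + x := by
  cases hτ with
  | equalChar => exact continuous_add_left_seriesTopology ..
  | standard => exact continuous_add_left_seriesTopology ..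
  | finite M OM hOM hM σM hσM h hh π hπ b =>
    let _ : TopologicalSpace M := seriesTopology OM σM h π
    let _ : TopologicalSpace F := TopologicalSpace.induced b.equivFun Pi.topologicalSpace
    show Continuous fun x : F => c + x
    rw [continuous_induced_rng]
    have h1 : b.equivFun ∘ (fun x => c + x) = (fun w => b.equivFun c + w) ∘ b.equivFun := by
      funext x
      simp
    rw [h1]
    refine Continuous.comp ?_ continuous_induced_dom
    exact continuous_pi fun i =>
      (continuous_add_left_seriesTopology OM σM h π (b.equivFun c i)).comp (continuous_apply i)

theorem IsHigherTopology.continuous_add_left {n : ℕ} {k : Type u} [Field k]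
    {σ : TopologicalSpace k} (hσ : IsHigherTopology n k σ) (c : k) :
    @Continuous k k σ σ fun x => c + x := by
  cases n with
  | zero =>
    obtain ⟨-, rfl⟩ := hσ
    exact continuous_bot
  | succ n =>
    obtain ⟨O, σ', -, -, h⟩ := hσ
    exact h.continuous_add_left c

/-! ### Openness of the residue map -/

/-- It suffices that each neighbourhood of an integral element reduces to a neighbourhood of its
reduction. -/
theorem isOpenMap_residue_of {F : Type u} [Field F] {O : ValuationSubring F}
    {σ : TopologicalSpace (IsLocalRing.ResidueField O)} {τ : TopologicalSpace F}
    (hσ : ∀ c, @Continuous _ _ σ σ fun x => c + x)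
    (hlift : ∀ W : Set F, IsOpen[τ] W → ∀ x : O, (x : F) ∈ W →
      ∃ N : Set (IsLocalRing.ResidueField O), IsOpen[σ] N ∧ 0 ∈ N ∧
        ∀ a ∈ N, ∃ y : O, (y : F) ∈ W ∧
          IsLocalRing.residue O y = IsLocalRing.residue O x + a) :
    @IsOpenMap O (IsLocalRing.ResidueField O) (TopologicalSpace.induced Subtype.val τ) σ
      (IsLocalRing.residue O) := by
  rintro S ⟨W, hW, rfl⟩
  refine (@isOpen_iff_forall_mem_open _ σ _).2 ?_
  rintro _ ⟨x, hx, rfl⟩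
  obtain ⟨N, hN, h0, hNW⟩ := hlift W hW x hx
  refine ⟨(fun a => -IsLocalRing.residue O x + a) ⁻¹' N, fun a ha => ?_,
    @IsOpen.preimage _ _ σ σ _ (hσ _) _ hN, by simpa using h0⟩
  obtain ⟨y, hy, hya⟩ := hNW _ ha
  exact ⟨y, hy, by rw [hya, add_neg_cancel_left]⟩

/-- The lifting of `a` is the value of a series concentrated in degree zero. -/
theorem lifting_mem_basicSet {F : Type u} [Field F] {O : ValuationSubring F}
    (hO : IsCompleteDVR O) {π : O} (hπ : Irreducible π) {h : IsLocalRing.ResidueField O → O}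
    (h0 : h 0 = 0) {U : ℤ → Set (IsLocalRing.ResidueField O)} (hU : ∀ i, 0 ∈ U i)
    {a : IsLocalRing.ResidueField O} (ha : a ∈ U 0) : (h a : F) ∈ basicSet O h π U := by
  refine ⟨Pi.single 0 a, fun i => ?_, isSeriesSum_of_sub_sum_mem_lat hO hπ (m := 0) h0
    (fun i hi => Pi.single_eq_of_ne hi.ne _) fun n hn => ?_⟩
  · by_cases hi : i = 0
    · subst hi
      simpa using ha
    · rw [Pi.single_eq_of_ne hi]
      exact hU i
  · rcases hn.eq_or_lt with rfl | hn
    · simpa using mem_lat_zero.2 (h a).2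
    · rw [Finset.sum_eq_single_of_mem 0 (by simpa using hn) fun i _ hi => by
        rw [Pi.single_eq_of_ne hi, h0]
        simp]
      simp

theorem isOpenMap_residue_seriesTopology {F : Type u} [Field F] {O : ValuationSubring F}
    (hO : IsCompleteDVR O) {π : O} (hπ : Irreducible π) {h : IsLocalRing.ResidueField O → O}
    (h0 : h 0 = 0) (hs : ∀ a, IsLocalRing.residue O (h a) = a)
    {σ : TopologicalSpace (IsLocalRing.ResidueField O)}
    (hσ : ∀ c, @Continuous _ _ σ σ fun x => c + x) :
    @IsOpenMap O (IsLocalRing.ResidueField O)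
      (TopologicalSpace.induced Subtype.val (seriesTopology O σ h π)) σ
      (IsLocalRing.residue O) := by
  refine isOpenMap_residue_of hσ fun W hW x hx => ?_
  obtain ⟨U, hU, hUW⟩ := hW _ hx
  exact ⟨U 0, hU.isOpen 0, hU.zero_mem 0, fun a ha => ⟨x + h a,
    hUW _ (lifting_mem_basicSet hO hπ h0 hU.zero_mem ha), by rw [map_add, hs]⟩⟩

/-- The case of a finite extension `F` of a standard field `M`. A small element of the residue field
of `F` has small coordinates over that of `M`, since coordinates are continuous. Its lift is formed
by means of the canonical liftings of the coordinates, and good subgroups of `M` control the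
coordinates of the lift. -/
theorem isOpenMap_residue_finite {n : ℕ} {F : Type u} [Field F] {O : ValuationSubring F}
    (hO : IsCompleteDVR O) {σ : TopologicalSpace (IsLocalRing.ResidueField O)}
    (hσ : IsHigherTopology n (IsLocalRing.ResidueField O) σ)
    (M : Subfield F) [FiniteDimensional M F] (OM : ValuationSubring M)
    (hOM : OM = O.comap (algebraMap M F)) (hM : IsCompleteDVR OM)
    (σM : TopologicalSpace (IsLocalRing.ResidueField OM))
    (hσM : IsHigherTopology n (IsLocalRing.ResidueField OM) σM)
    (h : IsLocalRing.ResidueField OM → OM) (hh : IsCanonicalLifting OM h)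
    (π : OM) (hπ : Irreducible π)
    (b : Module.Basis (Fin (Module.finrank M F)) M F) :
    @IsOpenMap O (IsLocalRing.ResidueField O)
      (TopologicalSpace.induced Subtype.val (TopologicalSpace.induced b.equivFun
          (@Pi.topologicalSpace _ (fun _ => M) (fun _ => seriesTopology OM σM h π)))) σ
      (IsLocalRing.residue O) := by
  refine isOpenMap_residue_of (fun c => hσ.continuous_add_left c) fun W hW x hx => ?_
  obtain ⟨h0, hs⟩ := hh.section_spec
  obtain ⟨p, hp, hchar, hgood⟩ := hh.hasGoodReduction
  have hfact : Fact p.Prime := ⟨hp⟩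
  have hgood := hgood n (RingEquiv.refl _) σM hσM
  have hlinM := IsHigherTopology.isLinearTop (p := p) n hσM
  have hc : ∀ y, algebraMap M F y ∈ O ↔ y ∈ OM := fun y => by rw [hOM]; rfl
  have hfin : (residueMap hc).Finite :=
    residueMap_finite hM hO (RingHom.finite_algebraMap.2 inferInstance) hc
  have : CharP (IsLocalRing.ResidueField O) p :=
    charP_of_injective_ringHom (residueMap hc).injective p
  -- A basis of the residue extension, and its coordinates.
  let _ := (residueMap hc).toAlgebra
  have : Module.Finite (IsLocalRing.ResidueField OM) (IsLocalRing.ResidueField O) := hfin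
  let e := Module.finBasis (IsLocalRing.ResidueField OM) (IsLocalRing.ResidueField O)
  have hcont : ∀ l, @Continuous _ _ σ σM fun a => e.repr a l := fun l =>
    continuous_of_semilinear (p := p) n hσM hσ hσM hfin
      (RingHom.Finite.id (IsLocalRing.ResidueField OM)) (e.coord l).toAddMonoidHom
      fun c a => (e.coord l).map_smul c a
  choose w hw using fun l => IsLocalRing.residue_surjective (e l)
  -- A box around `x` inside `W`, whose sides are translates of good subgroups.
  obtain ⟨W', hW', rfl⟩ := hW
  obtain ⟨V, hV, hVW⟩ := (@isOpen_pi_iff' _ _ (fun _ => seriesTopology OM σM h π) _ _).1 hW' _ hx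
  choose U hU hUV using fun j => (hV j).1 _ (hV j).2
  choose G hG hGU using fun j =>
    exists_good_le_basicSet hM hπ h0 hs hlinM hgood (hU j)
  choose A hA hAG using fun l j => hG j (b.equivFun (w l : F) j)
  refine ⟨⋂ l, ⋂ j, (fun a => e.repr a l) ⁻¹' (A l j), ?_, ?_, fun a ha => ?_⟩
  · exact @isOpen_iInter_of_finite _ _ σ _ _ fun l => @isOpen_iInter_of_finite _ _ σ _ _ fun j =>
      @IsOpen.preimage _ _ σ σM _ (hcont l) _ (hA l j)
  · simp only [Set.mem_iInter, Set.mem_preimage, map_zero, Finsupp.coe_zero, Pi.zero_apply]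
    exact fun l j => zero_mem _
  · simp only [Set.mem_iInter, Set.mem_preimage] at ha
    refine ⟨x + ∑ l, integerMap hc (h (e.repr a l)) * w l, hVW fun j _ => ?_, ?_⟩
    · have h1 : ((x + ∑ l, integerMap hc (h (e.repr a l)) * w l : O) : F) =
          x + ∑ l, (h (e.repr a l) : M) • (w l : F) := by
        push_cast
        simp only [coe_integerMap, Algebra.smul_def]
      rw [h1, map_add, map_sum]
      simp only [map_smul, Pi.add_apply, Finset.sum_apply, Pi.smul_apply, smul_eq_mul]
      exact hUV j _ (hGU j (AddSubgroup.sum_mem _ fun l _ => hAG l j _ (ha l j)))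
    · rw [map_add, map_sum]
      congr 1
      conv_rhs => rw [← e.sum_repr a]
      refine Finset.sum_congr rfl fun l _ => ?_
      rw [map_mul, hw, ← residueMap_residue, hs]
      rfl

end HigherLocal

theorem mainTheorem8 {F : Type u} [Field F] (n : ℕ)
    (O : ValuationSubring F) (hO : HigherLocal.IsCompleteDVR O)
    (hF : HigherLocal.IsHigherLocalField n (IsLocalRing.ResidueField O))
    (σ : TopologicalSpace (IsLocalRing.ResidueField O))
    (hσ : HigherLocal.IsHigherTopology n (IsLocalRing.ResidueField O) σ)
    (τ : TopologicalSpace F)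
    (hτ : HigherLocal.IsConstructedFrom (HigherLocal.IsHigherTopology n) O σ τ) :
    @IsOpenMap O (IsLocalRing.ResidueField O) (TopologicalSpace.induced Subtype.val τ) σ
      (IsLocalRing.residue O) := by
  cases hτ with
  | equalChar s hs π hπ =>
    exact HigherLocal.isOpenMap_residue_seriesTopology hO hπ (map_zero s) hs
      hσ.continuous_add_left
  | standard h hh π hπ =>
    exact HigherLocal.isOpenMap_residue_seriesTopology hO hπ hh.section_spec.1 hh.section_spec.2
      hσ.continuous_add_left
  | finite M OM hOM hM σM hσM h hh π hπ b =>
    exact HigherLocal.isOpenMap_residue_finite hO hσ M OM hOM hM σM hσM h hh π hπ b
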